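/- Let $X$ be a locally compact, paracompact Hausdorff space and let $G$ be an abelian group. Call a subset of $X$ bounded if its closure is compact. For $n\ge 0$ let $K_n(X,G)$ be the abelian group of all functions $f$ that assign an element $f(E_0,\dots,E_n)\in G$ to every $(n+1)$-tuple of bounded subsets of $X$ and satisfy: (1) $f$ is additive in each argument with respect to disjoint unions, i.e. if $E_i=E_i'\cup E_i''$ with $E_i'\cap E_i''=\varnothing$, then $f(\dots,E_i,\dots)=f(\dots,E_i',\dots)+f(\dots,E_i'',\dots)$; (2) $f$ is multiplied by the sign of the permutation when its arguments are permuted, and $f$ vanishes when two arguments are equal; (3) $f(E_0,\dots,E_n)=0$ whenever $\overline{E}_0\cap\dots\cap\overline{E}_n=\varnothing$. For $n\ge 1$ let $\Delta:K_n(X,G)\to K_{n-1}(X,G)$ be given by $\Delta f(E_0,\dots,E_{n-1})=f(U,E_0,\dots,E_{n-1})$, where $U$ is any open bounded set containing $\overline{E}_0\cup\dots\cup\overline{E}_{n-1}$ (the value does not depend on $U$). The Kolmogoroff homology group $H^K_n(X,G)$ is the $n$-th homology group of the chain complex $(K_*(X,G),\Delta)$. Let $\dot X=X\cup\{*\}$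 be the one-point (Alexandroff) compactification of $X$ (with $*$ isolated if $X$ is compact), and let $\check H^n(\dot X,*)$ be the $n$-th Čech cohomology group of the pair $(\dot X,\{*\})$ with integer coefficients, that is, the direct limit, over all open covers of $\dot X$ directed by refinement, of the $n$-th relative cohomology groups of the nerve of the cover modulo the nerve of its trace on $\{*\}$. Then for every integer $n\ge 0$ there is a short exact sequence of abelian groups $$0\longrightarrow \operatorname{Ext}\bigl(\check H^{n+1}(\dot X,*),G\bigr)\longrightarrow H^K_n(X,G)\longrightarrow \operatorname{Hom}\bigl(\check H^n(\dot X,*),G\bigr)\longrightarrow 0 .$$ -/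

import Mathlib

universe u v

open CategoryTheory

/-! ## Kolmogoroff homology -/

namespace Kolmogoroff

/-- The bounded subsets of `X`: those with compact closure. -/
abbrev Bounded (X : Type u) [TopologicalSpace X] : Type u :=
  {E : Set X // IsCompact (closure E)}

section

variable {X : Type u} [TopologicalSpace X]

/-- The union of two bounded sets, as a bounded set. -/
def Bounded.union (A B : Bounded X) : Bounded X :=
  ⟨A.1 ∪ B.1, by rw [closure_union]; exact A.2.union B.2⟩

/-- A subset of a bounded set, as a bounded set. -/
def Bounded.sub (A : Bounded X) (S : Set X) (h : S ⊆ A.1) : Bounded X :=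
  ⟨S, A.2.of_isClosed_subset isClosed_closure (closure_mono h)⟩

end

variable (X : Type u) [TopologicalSpace X] (G : Type v) [AddCommGroup G]

/-- `IsChain X G n f`: the function `f` of `n + 1` bounded sets is an `n`-dimensional
Kolmogoroff chain. -/
structure IsChain (n : ℕ) (f : (Fin (n + 1) → Bounded X) → G) : Prop where
  additive : ∀ (E : Fin (n + 1) → Bounded X) (i : Fin (n + 1)) (A B : Bounded X),
    Disjoint A.1 B.1 →
      f (Function.update E i (A.union B)) =
        f (Function.update E i A) + f (Function.update E i B)
  perm : ∀ (E : Fin (n + 1) → Bounded X) (σ : Equiv.Perm (Fin (n + 1))),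
    f (E ∘ σ) = (Equiv.Perm.sign σ : ℤ) • f E
  eq_zero_of_eq : ∀ (E : Fin (n + 1) → Bounded X) (i j : Fin (n + 1)),
    i ≠ j → E i = E j → f E = 0
  eq_zero_of_closures : ∀ E : Fin (n + 1) → Bounded X,
    ⋂ i, closure (E i).1 = ∅ → f E = 0

/-- The group `K_n(X, G)` of `n`-dimensional Kolmogoroff chains. -/
def chains (n : ℕ) : AddSubgroup ((Fin (n + 1) → Bounded X) → G) where
  carrier := {f | IsChain X G n f}
  zero_mem' := ⟨by simp, by simp, by simp, by simp⟩
  add_mem' {f g} hf hg :=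
    { additive := fun E i A B h => by
        simp only [Pi.add_apply, hf.additive E i A B h, hg.additive E i A B h]; abel
      perm := fun E σ => by simp only [Pi.add_apply, hf.perm E σ, hg.perm E σ, smul_add]
      eq_zero_of_eq := fun E i j h h' => by
        simp [hf.eq_zero_of_eq E i j h h', hg.eq_zero_of_eq E i j h h']
      eq_zero_of_closures := fun E h => by
        simp [hf.eq_zero_of_closures E h, hg.eq_zero_of_closures E h] }
  neg_mem' {f} hf :=
    { additive := fun E i A B h => by
        simp only [Pi.neg_apply, hf.additive E i A B h]; abel
      perm := fun E σ => by simp only [Pi.neg_apply, hf.perm E σ, smul_neg]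
      eq_zero_of_eq := fun E i j h h' => by simp [hf.eq_zero_of_eq E i j h h']
      eq_zero_of_closures := fun E h => by simp [hf.eq_zero_of_closures E h] }

variable {X} {G}

/-- `U` is an open set containing the closures of all the `E i`. -/
def IsHull {m : ℕ} (E : Fin m → Bounded X) (U : Bounded X) : Prop :=
  IsOpen U.1 ∧ ∀ i, closure (E i).1 ⊆ U.1

theorem exists_isHull [LocallyCompactSpace X] [T2Space X] {m : ℕ} (E : Fin m → Bounded X) :
    ∃ U : Bounded X, IsHull E U := by
  obtain ⟨V, hV, hKV, hVc⟩ := exists_isOpen_superset_and_isCompact_closure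
    (isCompact_iUnion fun i => (E i).2)
  exact ⟨⟨V, hVc⟩, hV, fun i => (Set.subset_iUnion _ i).trans hKV⟩

theorem IsChain.cons_eq_cons_inter {n : ℕ} {f : (Fin (n + 2) → Bounded X) → G}
    (hf : IsChain X G (n + 1) f) (E : Fin (n + 1) → Bounded X) (U V : Bounded X)
    (hV : IsHull E V) :
    f (Fin.cons U E) = f (Fin.cons (U.sub (U.1 ∩ V.1) Set.inter_subset_left) E) := by
  have key := hf.additive (Fin.cons U E) 0 (U.sub (U.1 ∩ V.1) Set.inter_subset_left)
    (U.sub (U.1 \ V.1) Set.sdiff_subset)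
    (Set.disjoint_left.2 fun x hx hx' => hx'.2 hx.2)
  have hU : (U.sub (U.1 ∩ V.1) Set.inter_subset_left).union
      (U.sub (U.1 \ V.1) Set.sdiff_subset) = U :=
    Subtype.ext (Set.inter_union_sdiff U.1 V.1)
  rw [hU] at key
  simp only [Fin.update_cons_zero] at key
  rw [key, add_eq_left]
  refine hf.eq_zero_of_closures _ (Set.eq_empty_of_forall_notMem fun x hx => ?_)
  rw [Set.mem_iInter] at hx
  have h0 : x ∈ closure (U.1 \ V.1) := hx 0
  have h1 : x ∈ closure (E 0).1 := hx (Fin.succ 0)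
  obtain ⟨y, hyV, hyU⟩ := mem_closure_iff.1 h0 V.1 hV.1 (hV.2 0 h1)
  exact hyU.2 hyV

theorem IsChain.cons_eq_cons {n : ℕ} {f : (Fin (n + 2) → Bounded X) → G}
    (hf : IsChain X G (n + 1) f) (E : Fin (n + 1) → Bounded X) (U V : Bounded X)
    (hU : IsHull E U) (hV : IsHull E V) : f (Fin.cons U E) = f (Fin.cons V E) := by
  rw [hf.cons_eq_cons_inter E U V hV, hf.cons_eq_cons_inter E V U hU]
  congr 2
  exact Subtype.ext (Set.inter_comm _ _)

variable [LocallyCompactSpace X] [T2Space X]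

/-- The boundary `Δf(E_0, …, E_n) = f(U, E_0, …, E_n)`, where `U` is an open bounded set that
contains the closures of all the `E_i`. -/
noncomputable def boundaryFun {n : ℕ} (f : (Fin (n + 2) → Bounded X) → G) :
    (Fin (n + 1) → Bounded X) → G :=
  fun E => f (Fin.cons (exists_isHull E).choose E)

/-- The boundary does not depend on the choice of `U`. -/
theorem IsChain.boundaryFun_eq {n : ℕ} {f : (Fin (n + 2) → Bounded X) → G}
    (hf : IsChain X G (n + 1) f) (E : Fin (n + 1) → Bounded X) (U : Bounded X)
    (hU : IsHull E U) : boundaryFun f E = f (Fin.cons U E) :=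
  hf.cons_eq_cons E _ U (exists_isHull E).choose_spec hU

theorem IsChain.boundaryFun {n : ℕ} {f : (Fin (n + 2) → Bounded X) → G}
    (hf : IsChain X G (n + 1) f) : IsChain X G n (boundaryFun f) where
  additive E i A B h := by
    obtain ⟨U, hU⟩ := exists_isHull (Function.update E i (A.union B))
    have hle : ∀ C : Bounded X, C.1 ⊆ (A.union B).1 → IsHull (Function.update E i C) U := by
      intro C hC
      refine ⟨hU.1, fun j => ?_⟩
      have hj := hU.2 j
      by_cases hji : j = i
      · subst hji
        rw [Function.update_self] at hj ⊢
        exact (closure_mono hC).trans hj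
      · rwa [Function.update_of_ne hji] at hj ⊢
    rw [hf.boundaryFun_eq _ U hU, hf.boundaryFun_eq _ U (hle A Set.subset_union_left),
      hf.boundaryFun_eq _ U (hle B Set.subset_union_right)]
    simp only [Fin.cons_update]
    exact hf.additive _ _ A B h
  perm E σ := by
    obtain ⟨U, hU⟩ := exists_isHull E
    rw [hf.boundaryFun_eq (E ∘ σ) U ⟨hU.1, fun i => hU.2 (σ i)⟩, hf.boundaryFun_eq E U hU]
    have h := hf.perm (Fin.cons U E) (Equiv.Perm.decomposeFin.symm (0, σ))
    rw [Equiv.Perm.decomposeFin.symm_sign, if_pos rfl, one_mul] at h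
    rw [← h]
    congr 1
    funext i
    refine Fin.cases ?_ (fun j => ?_) i
    · simp
    · simp [Equiv.Perm.decomposeFin_symm_apply_succ]
  eq_zero_of_eq E i j h h' := by
    obtain ⟨U, hU⟩ := exists_isHull E
    rw [hf.boundaryFun_eq E U hU]
    exact hf.eq_zero_of_eq _ i.succ j.succ (by simpa using h) (by simpa using h')
  eq_zero_of_closures E h := by
    obtain ⟨U, hU⟩ := exists_isHull E
    rw [hf.boundaryFun_eq E U hU]
    refine hf.eq_zero_of_closures _ (Set.eq_empty_of_forall_notMem fun x hx => ?_)
    rw [Set.mem_iInter] at hx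
    exact (h ▸ Set.mem_iInter.2 fun i => by simpa using hx i.succ : x ∈ (∅ : Set X))

variable (X G)

/-- The boundary operator `Δ : K_{n+1}(X, G) → K_n(X, G)`. -/
noncomputable def boundary (n : ℕ) : chains X G (n + 1) →+ chains X G n where
  toFun f := ⟨boundaryFun f.1, f.2.boundaryFun⟩
  map_zero' := rfl
  map_add' _ _ := rfl

theorem boundary_boundary (n : ℕ) (f : chains X G (n + 2)) :
    boundary X G n (boundary X G (n + 1) f) = 0 := by
  refine Subtype.ext (funext fun E => ?_)
  obtain ⟨U, hU⟩ := exists_isHull E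
  obtain ⟨V, hV⟩ := exists_isHull (Fin.cons U E : Fin (n + 2) → Bounded X)
  change boundaryFun (boundaryFun f.1) E = 0
  have hf : IsChain X G (n + 2) f.1 := f.2
  rw [hf.boundaryFun.boundaryFun_eq E U hU, hf.boundaryFun_eq _ V hV]
  have key := hf.additive (Fin.cons V (Fin.cons U E)) 0 U (V.sub (V.1 \ U.1) Set.sdiff_subset)
    Set.disjoint_sdiff_right
  have hUV : U.union (V.sub (V.1 \ U.1) Set.sdiff_subset) = V :=
    Subtype.ext (Set.union_sdiff_cancel (subset_closure.trans (hV.2 0)))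
  rw [hUV] at key
  simp only [Fin.update_cons_zero] at key
  rw [key, hf.eq_zero_of_eq _ 0 1 (by simp) rfl, zero_add]
  refine hf.eq_zero_of_closures _ (Set.eq_empty_of_forall_notMem fun x hx => ?_)
  rw [Set.mem_iInter] at hx
  have h0 : x ∈ closure (V.1 \ U.1) := hx 0
  have h1 : x ∈ closure (E 0).1 := hx (Fin.succ (Fin.succ 0))
  obtain ⟨y, hyU, hyV⟩ := mem_closure_iff.1 h0 U.1 hU.1 (hU.2 0 h1)
  exact hyV.2 hyU

/-- The chain complex `K_*(X, G)` of Kolmogoroff chains. -/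
noncomputable def complex : ChainComplex AddCommGrpCat.{max u v} ℕ :=
  ChainComplex.of (fun n => AddCommGrpCat.of (chains X G n))
    (fun n => AddCommGrpCat.ofHom (boundary X G n))
    (fun n => AddCommGrpCat.hom_ext (AddMonoidHom.ext (boundary_boundary X G n)))

/-- The `n`-th Kolmogoroff homology group of `X` with coefficients in `G`. -/
noncomputable abbrev homology (n : ℕ) : AddCommGrpCat.{max u v} := (complex X G).homology n

end Kolmogoroff

/-! ## Čech cohomology of a pair, with integer coefficients -/

namespace Cech

variable (Y : Type u) [TopologicalSpace Y]

/-- An open cover of `Y`. -/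
structure OpenCover where
  /-- The members of the cover. -/
  sets : Set (Set Y)
  isOpen : ∀ U ∈ sets, IsOpen U
  covers : ⋃₀ sets = Set.univ

variable {Y}

/-- `α ≤ β` means that `β` is a refinement of `α`. -/
instance : Preorder (OpenCover Y) where
  le α β := ∀ V ∈ β.sets, ∃ U ∈ α.sets, V ⊆ U
  le_refl _ V hV := ⟨V, hV, subset_rfl⟩
  le_trans _ _ _ h h' W hW := by
    obtain ⟨V, hV, hWV⟩ := h' W hW
    obtain ⟨U, hU, hVU⟩ := h V hV
    exact ⟨U, hU, hWV.trans hVU⟩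

/-- The intersection of the sets of a finite sequence of members of a cover. -/
def inter {α : OpenCover Y} {n : ℕ} (s : Fin (n + 1) → α.sets) : Set Y :=
  ⋂ i, (s i : Set Y)

/-- The ordered `n`-simplices of the nerve of a cover: the sequences of `n + 1` members of the
cover whose intersection is nonempty. -/
abbrev Simplex (α : OpenCover Y) (n : ℕ) : Type u :=
  {s : Fin (n + 1) → α.sets // (inter s).Nonempty}

theorem inter_subset_comp {α : OpenCover Y} {m n : ℕ} (s : Fin (n + 1) → α.sets)
    (g : Fin (m + 1) → Fin (n + 1)) : inter s ⊆ inter (s ∘ g) :=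
  Set.subset_iInter fun j => Set.iInter_subset _ (g j)

/-- The `i`-th face of an ordered simplex. -/
def Simplex.face {α : OpenCover Y} {n : ℕ} (s : Simplex α (n + 1)) (i : Fin (n + 2)) :
    Simplex α n :=
  ⟨s.1 ∘ i.succAbove, s.2.mono (inter_subset_comp s.1 i.succAbove)⟩

/-- The integral `n`-cochains on the nerve of `α` relative to the nerve of the trace of `α` on
`A`: the functions on ordered simplices that vanish on those whose intersection meets `A`. -/
def cochains (A : Set Y) (α : OpenCover Y) (n : ℕ) : AddSubgroup (Simplex α n → ℤ) where
  carrier := {c | ∀ s : Simplex α n, (inter s.1 ∩ A).Nonempty → c s = 0}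
  zero_mem' _ _ := rfl
  add_mem' ha hb s hs := by simp [ha s hs, hb s hs]
  neg_mem' ha s hs := by simp [ha s hs]

variable (A : Set Y)

/-- The coboundary operator. -/
def coboundary (α : OpenCover Y) (n : ℕ) : cochains A α n →+ cochains A α (n + 1) where
  toFun c := ⟨fun s => ∑ i : Fin (n + 2), (-1) ^ (i : ℕ) * c.1 (s.face i), fun s hs =>
    Finset.sum_eq_zero fun i _ => by
      rw [c.2 (s.face i)
        (hs.mono (Set.inter_subset_inter_left A (inter_subset_comp s.1 i.succAbove))), mul_zero]⟩
  map_zero' := Subtype.ext (funext fun s => by simp)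
  map_add' c d := Subtype.ext (funext fun s => by simp [mul_add, Finset.sum_add_distrib])

theorem coboundary_coboundary (α : OpenCover Y) (n : ℕ) (c : cochains A α n) :
    coboundary A α (n + 1) (coboundary A α n c) = 0 := by
  refine Subtype.ext (funext fun s => ?_)
  change ∑ i : Fin (n + 3), (-1 : ℤ) ^ (i : ℕ) *
    ∑ j : Fin (n + 2), (-1) ^ (j : ℕ) * c.1 ((s.face i).face j) = 0
  simp only [Finset.mul_sum]
  rw [← Finset.sum_product', Finset.univ_product_univ]
  refine Finset.sum_involution (fun p _ => (p.1.succAbove p.2, p.2.predAbove p.1)) ?_ ?_ ?_ ?_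
  · rintro ⟨i, j⟩ -
    have hface : (s.face (i.succAbove j)).face (j.predAbove i) = (s.face i).face j := by
      refine Subtype.ext (funext fun k => ?_)
      exact congrArg s.1 (Fin.succAbove_succAbove_succAbove_predAbove i j k)
    have hsign : (-1 : ℤ) ^ ((i.succAbove j : Fin (n + 3)) : ℕ) *
        (-1) ^ ((j.predAbove i : Fin (n + 2)) : ℕ) = -((-1) ^ (i : ℕ) * (-1) ^ (j : ℕ)) := by
      rw [← pow_add, Fin.neg_one_pow_succAbove_add_predAbove, pow_add]
    simp only
    rw [hface, ← mul_assoc, ← mul_assoc, hsign]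
    ring
  · rintro ⟨i, j⟩ - - h
    exact Fin.succAbove_ne i j (congrArg Prod.fst h)
  · intro _ _
    exact Finset.mem_univ _
  · rintro ⟨i, j⟩ -
    exact Prod.ext (Fin.succAbove_succAbove_predAbove i j) (Fin.predAbove_predAbove_succAbove i j)

/-- The complex of relative cochains on the nerve of `α`. -/
def complex (α : OpenCover Y) : CochainComplex AddCommGrpCat.{u} ℕ :=
  CochainComplex.of (fun n => AddCommGrpCat.of (cochains A α n))
    (fun n => AddCommGrpCat.ofHom (coboundary A α n))
    (fun n => AddCommGrpCat.hom_ext (AddMonoidHom.ext (coboundary_coboundary A α n)))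

/-- A projection from the refinement `β` to `α`: it sends each member of `β` to a member of `α`
that contains it. -/
structure Projection (α β : OpenCover Y) where
  /-- The underlying map between the sets of vertices of the nerves. -/
  toFun : β.sets → α.sets
  subset : ∀ V : β.sets, (V : Set Y) ⊆ toFun V

/-- A choice of projection; any two projections induce the same map on cohomology. -/
noncomputable def projection {α β : OpenCover Y} (h : α ≤ β) : Projection α β where
  toFun V := ⟨(h V.1 V.2).choose, (h V.1 V.2).choose_spec.1⟩
  subset V := (h V.1 V.2).choose_spec.2

theorem Projection.inter_subset {α β : OpenCover Y} (p : Projection α β) {n : ℕ}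
    (s : Fin (n + 1) → β.sets) : inter s ⊆ inter (p.toFun ∘ s) :=
  Set.iInter_mono fun i => p.subset (s i)

/-- The map that a projection induces on relative cochains. -/
def Projection.pullback {α β : OpenCover Y} (p : Projection α β) (n : ℕ) :
    cochains A α n →+ cochains A β n where
  toFun c := ⟨fun s => c.1 ⟨p.toFun ∘ s.1, s.2.mono (p.inter_subset s.1)⟩, fun s hs =>
    c.2 _ (hs.mono (Set.inter_subset_inter_left A (p.inter_subset s.1)))⟩
  map_zero' := rfl
  map_add' _ _ := rfl

/-- The cochain map induced by a projection. -/
def Projection.map {α β : OpenCover Y} (p : Projection α β) : complex A α ⟶ complex A β :=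
  CochainComplex.ofHom (fun n => AddCommGrpCat.ofHom (p.pullback A n))
    (fun n => by
      simp only [complex, CochainComplex.of_d]
      rfl)

open Classical in
/-- The `n`-th Čech cohomology group of the pair `(Y, A)` with integer coefficients: the direct
limit, over all open covers of `Y` directed by refinement, of the cohomology groups of the pairs
of nerves. -/
abbrev cohomology (n : ℕ) : Type u :=
  AddCommGroup.DirectLimit (fun α : OpenCover Y => ((complex A α).homology n : Type u))
    (fun _ _ h => (HomologicalComplex.homologyMap ((projection h).map A) n).hom)

end Cech

/-! ## The group `Ext` of abelian groups -/

/-- `Ext¹(A, G)` for abelian groups `A` and `G`, possibly in different universes. -/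
abbrev ExtAb (A : Type u) (G : Type v) [AddCommGroup A] [AddCommGroup G] : Type (max u v) :=
  Abelian.Ext (ModuleCat.of ℤ (ULift.{v} A)) (ModuleCat.of ℤ (ULift.{u} G)) 1

-- Let `Y` be the one-point compactification of `X` and `p` the point at infinity. The bounded
-- subsets of `X` are the subsets of `Y` whose closure misses `p`. Sets `E₀, …, Eₙ` have closures
-- with a common point exactly when there are ultrafilters `sᵢ ∋ Eᵢ` with a common limit. This
-- suggests the group Cⁿ of integral functions on (n+1)-tuples of ultrafilters with a common limit
-- that is generated by the determinants of the 0/1 matrices recording whether `Eᵢ ∈ sⱼ` (`detFun`).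
-- These determinants are additive, alternating and vanish when the closures have no common point,
-- and they are universal for this: every linear relation between them holds for the values of every
-- chain (`IsChain.sum_eq_zero`). Hence Kₙ(X, G) = Hom(Cⁿ, G). Prefixing an open hull `U` adds a row
-- of ones where it matters, so Laplace expansion along that row makes Δ the dual of the coboundary
-- of C* (`coboundary_detFun`).
--
-- The functions in Cⁿ take finitely many values, so Cⁿ is free by Nöbeling's theorem
-- (`free_of_finite_range`), and the universal coefficient theorem (`exists_universalCoefficients`)
-- gives the exact sequence with the cohomology of C* in place of Čech cohomology.
--
-- It remains to identify the two cohomologies. The elements of Cⁿ are exactly the pullbacks of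
-- alternating relative cochains on the nerves of the fibre closures of finite labellings of `Y`
-- (`exists_isPull`, `mem_of_isPull`). A finite closed cover swells to an open cover with the same
-- nerve (`exists_swelling`), and every open cover admits a finite partition whose parts have
-- closures inside its members (`OpenCover.exists_partition`). The different ways of passing between
-- covers, and alternation, agree up to coboundaries by an acyclic carrier argument
-- (`isCobd_of_isCarried`).

universe w

/-! ## Cochains on tuples -/

namespace TupleCochain

variable {V W : Type*}

/-- The integral `n`-cochains on the full simplex with vertex set `V`. -/
abbrev Cochain (V : Type*) (n : ℕ) : Type _ := (Fin (n + 1) → V) → ℤ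

/-- The coboundary of a cochain on tuples. -/
def δ {n : ℕ} : Cochain V n →+ Cochain V (n + 1) where
  toFun c s := ∑ i : Fin (n + 2), (-1) ^ (i : ℕ) * c (s ∘ i.succAbove)
  map_zero' := funext fun s => by simp
  map_add' c d := funext fun s => by simp [mul_add, Finset.sum_add_distrib]

theorem δ_apply {n : ℕ} (c : Cochain V n) (s : Fin (n + 2) → V) :
    δ c s = ∑ i : Fin (n + 2), (-1) ^ (i : ℕ) * c (s ∘ i.succAbove) := rfl

theorem δ_δ {n : ℕ} (c : Cochain V n) : δ (δ c) = 0 := by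
  refine funext fun s => ?_
  simp only [δ_apply, Finset.mul_sum]
  rw [← Finset.sum_product', Finset.univ_product_univ]
  refine Finset.sum_involution (fun p _ => (p.1.succAbove p.2, p.2.predAbove p.1)) ?_ ?_ ?_ ?_
  · rintro ⟨i, j⟩ -
    have hface : (s ∘ (i.succAbove j).succAbove) ∘ (j.predAbove i).succAbove =
        (s ∘ i.succAbove) ∘ j.succAbove :=
      funext fun k => congrArg s (Fin.succAbove_succAbove_succAbove_predAbove i j k)
    have hsign : (-1 : ℤ) ^ ((i.succAbove j : Fin (n + 3)) : ℕ) *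
        (-1) ^ ((j.predAbove i : Fin (n + 2)) : ℕ) = -((-1) ^ (i : ℕ) * (-1) ^ (j : ℕ)) := by
      rw [← pow_add, Fin.neg_one_pow_succAbove_add_predAbove, pow_add]
    simp only
    rw [hface, ← mul_assoc, ← mul_assoc, hsign]
    ring
  · rintro ⟨i, j⟩ - - h
    exact Fin.succAbove_ne i j (congrArg Prod.fst h)
  · intro _ _
    exact Finset.mem_univ _
  · rintro ⟨i, j⟩ -
    exact Prod.ext (Fin.succAbove_succAbove_predAbove i j) (Fin.predAbove_predAbove_succAbove i j)

/-- Evaluation of a cochain on cones with apex `v`. -/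
def cone {n : ℕ} (v : V) : Cochain V (n + 1) →+ Cochain V n where
  toFun c s := c (Fin.cons v s)
  map_zero' := rfl
  map_add' _ _ := rfl

theorem cone_apply {n : ℕ} (v : V) (c : Cochain V (n + 1)) (s : Fin (n + 1) → V) :
    cone v c s = c (Fin.cons v s) := rfl

theorem cone_δ_zero (v : V) (c : Cochain V 0) :
    cone v (δ c) = c - fun _ => c fun _ => v := by
  refine funext fun s => ?_
  rw [cone_apply, δ_apply, Fin.sum_univ_two]
  have h0 : (Fin.cons v s : Fin 2 → V) ∘ Fin.succAbove 0 = s := by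
    funext j; simp
  have h1 : (Fin.cons v s : Fin 2 → V) ∘ Fin.succAbove 1 = fun _ => v := by
    funext j
    rw [Subsingleton.elim j 0]
    rfl
  rw [h0, h1]
  simp [sub_eq_add_neg]

/-- Coning at `v` contracts the full simplex: face 0 of a cone is its base, and the other faces are
cones over the faces of the base. In degree 0 the contraction fails by a constant, whence
`cone_δ_zero`. -/
theorem cone_δ {n : ℕ} (v : V) (c : Cochain V (n + 1)) :
    cone v (δ c) = c - δ (cone v c) := by
  refine funext fun s => ?_
  rw [cone_apply, δ_apply, Fin.sum_univ_succ, Pi.sub_apply, δ_apply, sub_eq_add_neg,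
    ← Finset.sum_neg_distrib]
  congr 1
  · rw [show (Fin.cons v s : Fin (n + 3) → V) ∘ Fin.succAbove 0 = s from by funext j; simp]
    simp
  · refine Finset.sum_congr rfl fun i _ => ?_
    have : (Fin.cons v s : Fin (n + 3) → V) ∘ i.succ.succAbove =
        Fin.cons v (s ∘ i.succAbove) := by
      funext j
      refine Fin.cases ?_ (fun j => ?_) j
      · simp
      · simp
    rw [this, cone_apply, Fin.val_succ, pow_succ]
    ring

/-! ### Homotopies with acyclic carrier -/

/-- The homotopy obtained by iterated coning from a cochain map `T` and a choice of apexes. -/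
def homotopy (T : ∀ n, Cochain V n →+ Cochain W n) (a : ∀ n, (Fin (n + 1) → W) → V) :
    ∀ n, Cochain V (n + 1) →+ Cochain W n
  | 0 =>
    { toFun := fun c s => T 0 (cone (a 0 s) c) s
      map_zero' := funext fun s => by simp
      map_add' := fun c d => funext fun s => by simp }
  | n + 1 =>
    { toFun := fun c s => T (n + 1) (cone (a (n + 1) s) c) s -
        δ (homotopy T a n (cone (a (n + 1) s) c)) s
      map_zero' := funext fun s => by simp
      map_add' := fun c d => funext fun s => by
        simp only [map_add, Pi.add_apply]; abel }

section

variable {T : ∀ n, Cochain V n →+ Cochain W n} {a : ∀ n, (Fin (n + 1) → W) → V}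

theorem homotopy_succ_apply (n : ℕ) (c : Cochain V (n + 2)) (s : Fin (n + 2) → W) :
    homotopy T a (n + 1) c s = T (n + 1) (cone (a (n + 1) s) c) s -
        δ (homotopy T a n (cone (a (n + 1) s) c)) s := rfl

theorem homotopy_δ_zero (hconst : ∀ z : ℤ, T 0 (fun _ => z) = 0) (c : Cochain V 0) :
    homotopy T a 0 (δ c) = T 0 c := by
  refine funext fun s => ?_
  change T 0 (cone (a 0 s) (δ c)) s = _
  rw [cone_δ_zero, map_sub, hconst, sub_zero]

theorem homotopy_δ_succ (hT : ∀ n c, T (n + 1) (δ c) = δ (T n c))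
    (hconst : ∀ z : ℤ, T 0 (fun _ => z) = 0) (n : ℕ) (c : Cochain V (n + 1)) :
    homotopy T a (n + 1) (δ c) + δ (homotopy T a n c) = T (n + 1) c := by
  -- The homotopy identity one degree lower, after applying δ. It cancels the terms containing `cone
  -- (a (n + 1) s) c`, so the apex may vary with `s`.
  have key : ∀ b : Cochain V n, T (n + 1) (δ b) = δ (homotopy T a n (δ b)) := by
    intro b
    rw [hT]
    cases n with
    | zero => rw [homotopy_δ_zero hconst]
    | succ n =>
      rw [← homotopy_δ_succ hT hconst n b, map_add, δ_δ, add_zero]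
  refine funext fun s => ?_
  rw [Pi.add_apply, homotopy_succ_apply, cone_δ, map_sub, key, map_sub, map_sub, Pi.sub_apply,
    Pi.sub_apply]
  ring

/-- `T` is carried by `Car`: the value of `T c` at `s` depends only on the values of `c` at the
tuples in `Car (range s)`. -/
def IsCarried (Car : Set W → Set V) {m n : ℕ} (T : Cochain V m →+ Cochain W n) : Prop :=
  ∀ c s, (∀ t, Set.range t ⊆ Car (Set.range s) → c t = 0) → T c s = 0

theorem IsCarried.sub {Car : Set W → Set V} {m n : ℕ} {T T' : Cochain V m →+ Cochain W n}
    (h : IsCarried Car T) (h' : IsCarried Car T') : IsCarried Car (T - T') := fun c s hc => by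
  simp [h c s hc, h' c s hc]

theorem range_cons_subset {n : ℕ} {v : V} {t : Fin n → V} {A : Set V} (hv : v ∈ A)
    (ht : Set.range t ⊆ A) : Set.range (Fin.cons v t : Fin (n + 1) → V) ⊆ A := by
  rintro _ ⟨j, rfl⟩
  refine Fin.cases ?_ (fun j => ?_) j
  · simpa using hv
  · simpa using ht ⟨j, rfl⟩

/-- With apexes in the carrier of `s`, every cone that occurs stays in it; the faces of `s` have
smaller carriers by monotonicity. -/
theorem isCarried_homotopy {Car : Set W → Set V} (hCar : Monotone Car)
    (hT : ∀ n, IsCarried Car (T n)) (ha : ∀ n s, a n s ∈ Car (Set.range s)) (n : ℕ) :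
    IsCarried Car (homotopy T a n) := by
  induction n with
  | zero =>
    intro c s hc
    exact hT 0 _ _ fun t ht => hc _ (range_cons_subset (ha 0 s) ht)
  | succ n ih =>
    intro c s hc
    have h1 : T (n + 1) (cone (a (n + 1) s) c) s = 0 :=
      hT _ _ _ fun t ht => hc _ (range_cons_subset (ha _ s) ht)
    rw [homotopy_succ_apply, h1, δ_apply, Finset.sum_eq_zero, sub_zero]
    intro i _
    rw [ih, mul_zero]
    intro t ht
    exact hc _ (range_cons_subset (ha _ s) (ht.trans (hCar (Set.range_comp_subset_range _ _))))

end

/-- The pullback of cochains along a map of vertices. -/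
def pull {n : ℕ} (φ : W → V) : Cochain V n →+ Cochain W n where
  toFun c s := c (φ ∘ s)
  map_zero' := rfl
  map_add' _ _ := rfl

theorem pull_apply {n : ℕ} (φ : W → V) (c : Cochain V n) (s : Fin (n + 1) → W) :
    pull φ c s = c (φ ∘ s) := rfl

theorem pull_δ {n : ℕ} (φ : W → V) (c : Cochain V n) : pull φ (δ c) = δ (pull φ c) := rfl

/-! ### Alternating cochains -/

theorem swap_succ_succAbove {n : ℕ} (k j : Fin (n + 1)) :
    Equiv.swap k.castSucc k.succ (k.succ.succAbove j) = k.castSucc.succAbove j := by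
  rw [Equiv.swap_apply_def]
  ext
  simp only [Fin.succAbove, Fin.lt_def, Fin.ext_iff, apply_ite Fin.val, Fin.val_castSucc,
    Fin.val_succ]
  split_ifs <;> omega

/-- A cochain is alternating if permuting the vertices multiplies it by the sign. -/
def IsAlt {n : ℕ} (c : Cochain V n) : Prop :=
  ∀ (s : Fin (n + 1) → V) (σ : Equiv.Perm (Fin (n + 1))),
    c (s ∘ σ) = (Equiv.Perm.sign σ : ℤ) * c s

namespace IsAlt

variable {n : ℕ} {c d : Cochain V n}

theorem zero : IsAlt (0 : Cochain V n) := fun s σ => by simp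

theorem add (hc : IsAlt c) (hd : IsAlt d) : IsAlt (c + d) := fun s σ => by
  simp [hc s σ, hd s σ, mul_add]

theorem neg (hc : IsAlt c) : IsAlt (-c) := fun s σ => by simp [hc s σ]

theorem sub (hc : IsAlt c) (hd : IsAlt d) : IsAlt (c - d) := by
  rw [sub_eq_add_neg]; exact hc.add hd.neg

theorem pull (hc : IsAlt c) (φ : W → V) : IsAlt (pull φ c) := fun s σ => hc (φ ∘ s) σ

/-- A repeated vertex gives `c s = -c s`, and ℤ has no 2-torsion. -/
theorem eq_zero (hc : IsAlt c) {s : Fin (n + 1) → V} (hs : ¬ Function.Injective s) : c s = 0 := by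
  simp only [Function.Injective, not_forall] at hs
  obtain ⟨i, j, hij, hne⟩ := hs
  have h := hc s (Equiv.swap i j)
  have h' : s ∘ Equiv.swap i j = s := by
    funext k
    by_cases hki : k = i
    · subst hki; simp [hij]
    · by_cases hkj : k = j
      · subst hkj; simp [hij]
      · simp [Equiv.swap_apply_of_ne_of_ne hki hkj]
  rw [h', Equiv.Perm.sign_swap hne] at h
  simp at h
  omega

/-- Swapping two adjacent vertices exchanges the two faces opposite to them, whose signs in δ are
opposite, and acts by a transposition on every other face. Adjacent transpositions generate all
permutations, so this suffices for `IsAlt.δ`. -/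
theorem δ_swap (hc : IsAlt c) (s : Fin (n + 2) → V) (k : Fin (n + 1)) :
    δ c (s ∘ Equiv.swap k.castSucc k.succ) = -δ c s := by
  rw [δ_apply, δ_apply, ← Equiv.sum_comp (Equiv.swap k.castSucc k.succ),
    ← Finset.sum_neg_distrib]
  refine Finset.sum_congr rfl fun i _ => ?_
  by_cases hi : i = k.castSucc
  · subst hi
    have : (s ∘ Equiv.swap k.castSucc k.succ) ∘ k.succ.succAbove =
        s ∘ k.castSucc.succAbove :=
      funext fun j => congrArg s (swap_succ_succAbove k j)
    rw [Equiv.swap_apply_left, this]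
    simp [pow_succ]
  by_cases hi' : i = k.succ
  · subst hi'
    have : (s ∘ Equiv.swap k.castSucc k.succ) ∘ k.castSucc.succAbove =
        s ∘ k.succ.succAbove := funext fun j => congrArg s (by
      rw [← swap_succ_succAbove, Equiv.swap_apply_self])
    rw [Equiv.swap_apply_right, this]
    simp [pow_succ]
  · rw [Equiv.swap_apply_of_ne_of_ne hi hi']
    obtain ⟨x, hx⟩ := Fin.exists_succAbove_eq (Ne.symm hi)
    obtain ⟨y, hy⟩ := Fin.exists_succAbove_eq (Ne.symm hi')
    have hxy : x ≠ y := by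
      rintro rfl
      exact absurd (hx.symm.trans hy) (Fin.castSucc_lt_succ).ne
    rw [← hx, ← hy, Function.comp_assoc,
      (Fin.succAbove_right_injective (p := i)).swap_comp x y, ← Function.comp_assoc, hc,
      Equiv.Perm.sign_swap hxy]
    simp

theorem δ (hc : IsAlt c) : IsAlt (δ c) := by
  intro s σ
  have hσ : σ ∈ Submonoid.closure
      (Set.range fun i : Fin (n + 1) => Equiv.swap i.castSucc i.succ) := by
    rw [Equiv.Perm.mclosure_swap_castSucc_succ]; trivial
  induction hσ using Submonoid.closure_induction generalizing s with
  | mem x hx =>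
    obtain ⟨k, rfl⟩ := hx
    rw [hc.δ_swap, Equiv.Perm.sign_swap (Fin.castSucc_lt_succ).ne]
    simp
  | one => simp
  | mul x y _ _ hx hy =>
    rw [Equiv.Perm.coe_mul, ← Function.comp_assoc, hy, hx]
    simp only [map_mul, Units.val_mul]
    ring

end IsAlt

/-! ### Alternation with respect to a linear order of the vertices -/

section Alternation

variable [LinearOrder V]

open Classical in
/-- The alternating cochain with the same values as `c` on increasing tuples. -/
noncomputable def alt {n : ℕ} : Cochain V n →+ Cochain V n where
  toFun c s := if Function.Injective s then
    (Equiv.Perm.sign (Tuple.sort s) : ℤ) * c (s ∘ Tuple.sort s) else 0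
  map_zero' := funext fun s => by simp
  map_add' c d := funext fun s => by
    by_cases h : Function.Injective s <;> simp [h, mul_add]

theorem alt_apply {n : ℕ} (c : Cochain V n) {s : Fin (n + 1) → V} (hs : Function.Injective s) :
    alt c s = (Equiv.Perm.sign (Tuple.sort s) : ℤ) * c (s ∘ Tuple.sort s) := if_pos hs

theorem alt_apply_of_strictMono {n : ℕ} (c : Cochain V n) {s : Fin (n + 1) → V}
    (hs : StrictMono s) : alt c s = c s := by
  rw [alt_apply c hs.injective, Tuple.sort_eq_refl_iff_monotone.2 hs.monotone]
  simp

theorem isAlt_alt {n : ℕ} (c : Cochain V n) : IsAlt (alt c) := by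
  intro s σ
  by_cases hs : Function.Injective s
  · rw [alt_apply c (hs.comp σ.injective), alt_apply c hs,
      Tuple.comp_perm_comp_sort_eq_comp_sort]
    have : σ * Tuple.sort (s ∘ σ) = Tuple.sort s := by
      have h := Tuple.comp_perm_comp_sort_eq_comp_sort (f := s) (σ := σ)
      ext i
      exact congrArg Fin.val (hs (congrFun h i))
    rw [← this, map_mul, Units.val_mul, ← mul_assoc, ← mul_assoc, ← Units.val_mul (Equiv.Perm.sign σ),
      Int.units_mul_self, Units.val_one, one_mul]
  · have hs' : ¬ Function.Injective (s ∘ σ) := fun h => hs (by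
      have := h.comp σ.symm.injective
      rwa [Function.comp_assoc, Equiv.self_comp_symm] at this)
    simp [alt, hs, hs']

theorem IsAlt.ext {n : ℕ} {c d : Cochain V n} (hc : IsAlt c) (hd : IsAlt d)
    (h : ∀ s, StrictMono s → c s = d s) : c = d := by
  funext s
  by_cases hs : Function.Injective s
  · have h1 := hc s (Tuple.sort s)
    have h2 := hd s (Tuple.sort s)
    rw [h _ ((Tuple.monotone_sort s).strictMono_of_injective
      (hs.comp (Tuple.sort s).injective)), h2] at h1
    exact (mul_left_cancel₀ (Units.ne_zero _) h1).symm
  · rw [hc.eq_zero hs, hd.eq_zero hs]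

theorem IsAlt.alt_eq {n : ℕ} {c : Cochain V n} (hc : IsAlt c) : alt c = c :=
  (isAlt_alt c).ext hc fun _ hs => alt_apply_of_strictMono c hs

/-- Both sides are alternating, hence determined on increasing tuples, and faces of increasing
tuples are increasing. -/
theorem alt_δ {n : ℕ} (c : Cochain V n) : alt (δ c) = δ (alt c) := by
  refine (isAlt_alt _).ext (isAlt_alt c).δ fun s hs => ?_
  rw [alt_apply_of_strictMono _ hs, δ_apply, δ_apply]
  refine Finset.sum_congr rfl fun i _ => ?_
  rw [alt_apply_of_strictMono c (hs.comp (Fin.strictMono_succAbove i))]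

theorem alt_eq_zero {n : ℕ} {c : Cochain V n} {s : Fin (n + 1) → V}
    (h : ∀ t, Set.range t ⊆ Set.range s → c t = 0) : alt c s = 0 := by
  by_cases hs : Function.Injective s
  · rw [alt_apply c hs, h _ (Set.range_comp_subset_range _ _), mul_zero]
  · exact if_neg hs

end Alternation

end TupleCochain

/-! ## Relative cohomology of the nerve of an indexed family of sets -/

namespace Nerve

open TupleCochain

variable {Y V W : Type*}

/-- A tuple of indices is a simplex of the nerve of `Z` if its sets have a common point. -/
def IsSimplex (Z : V → Set Y) {n : ℕ} (s : Fin (n + 1) → V) : Prop :=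
  ∃ y, ∀ i, y ∈ Z (s i)

theorem IsSimplex.mono {Z Z' : V → Set Y} (h : ∀ v, Z v ⊆ Z' v) {n : ℕ} {s : Fin (n + 1) → V}
    (hs : IsSimplex Z s) : IsSimplex Z' s :=
  hs.imp fun _ hy i => h _ (hy i)

theorem IsSimplex.of_range_subset {Z : V → Set Y} {m n : ℕ} {s : Fin (n + 1) → V}
    {t : Fin (m + 1) → V} (hs : IsSimplex Z s) (h : Set.range t ⊆ Set.range s) :
    IsSimplex Z t := by
  obtain ⟨y, hy⟩ := hs
  refine ⟨y, fun i => ?_⟩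
  obtain ⟨j, hj⟩ := h ⟨i, rfl⟩
  exact hj ▸ hy j

variable (p : Y)

/-- Cochains that vanish on the simplices of the nerve of the trace on `{p}`. -/
def IsRel (Z : V → Set Y) {n : ℕ} (c : Cochain V n) : Prop :=
  ∀ s, (∀ i, p ∈ Z (s i)) → c s = 0

/-- The coboundary of `c` vanishes on the nerve of `Z`. -/
def IsCocycle (Z : V → Set Y) {n : ℕ} (c : Cochain V n) : Prop :=
  ∀ s, IsSimplex Z s → δ c s = 0

/-- On the nerve of `Z`, `c` is the coboundary of a relative cochain. -/
def IsCobd (Z : V → Set Y) : ∀ {n : ℕ}, Cochain V n → Prop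
  | 0, c => ∀ s, IsSimplex Z s → c s = 0
  | _ + 1, c => ∃ b, IsRel p Z b ∧ ∀ s, IsSimplex Z s → c s = δ b s

variable {p} {Z : V → Set Y} {ZW : W → Set Y} {n : ℕ}

theorem IsRel.add {c d : Cochain V n} (hc : IsRel p Z c) (hd : IsRel p Z d) :
    IsRel p Z (c + d) := fun s hs => by simp [hc s hs, hd s hs]

theorem IsRel.pull {c : Cochain V n} (hc : IsRel p Z c) {φ : W → V}
    (hp : ∀ w, p ∈ ZW w → p ∈ Z (φ w)) : IsRel p ZW (pull φ c) :=
  fun _ hs => hc _ fun i => hp _ (hs i)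

theorem IsRel.alt [LinearOrder V] {c : Cochain V n} (hc : IsRel p Z c) : IsRel p Z (alt c) :=
  fun _ hs => alt_eq_zero fun t ht => hc t fun i => by
    obtain ⟨j, hj⟩ := ht ⟨i, rfl⟩
    exact hj ▸ hs j

theorem IsCobd.add {c d : Cochain V n} (hc : IsCobd p Z c) (hd : IsCobd p Z d) :
    IsCobd p Z (c + d) := by
  cases n with
  | zero => intro s hs; simp [hc s hs, hd s hs]
  | succ n =>
    obtain ⟨b, hb, hcb⟩ := hc
    obtain ⟨b', hb', hdb⟩ := hd
    exact ⟨b + b', hb.add hb', fun s hs => by simp [hcb s hs, hdb s hs]⟩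

theorem IsCobd.neg {c : Cochain V n} (hc : IsCobd p Z c) : IsCobd p Z (-c) := by
  cases n with
  | zero => intro s hs; simp [hc s hs]
  | succ n =>
    obtain ⟨b, hb, hcb⟩ := hc
    exact ⟨-b, fun s hs => by simp [hb s hs], fun s hs => by simp [hcb s hs]⟩

theorem IsCobd.trans {c d e : Cochain V n} (h : IsCobd p Z (c - d)) (h' : IsCobd p Z (d - e)) :
    IsCobd p Z (c - e) := by
  simpa using h.add h'

theorem IsCobd.symm {c d : Cochain V n} (h : IsCobd p Z (c - d)) : IsCobd p Z (d - c) := by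
  simpa using h.neg

theorem IsCobd.congr {c d : Cochain V n} (hc : IsCobd p Z c)
    (h : ∀ s, IsSimplex Z s → d s = c s) : IsCobd p Z d := by
  cases n with
  | zero => intro s hs; rw [h s hs, hc s hs]
  | succ n =>
    obtain ⟨b, hb, hcb⟩ := hc
    exact ⟨b, hb, fun s hs => by rw [h s hs, hcb s hs]⟩

theorem isCobd_sub_of_eq {c d : Cochain V n} (h : ∀ s, IsSimplex Z s → c s = d s) :
    IsCobd p Z (c - d) := by
  cases n with
  | zero => intro s hs; simp [h s hs]
  | succ n => exact ⟨0, fun _ _ => rfl, fun s hs => by simp [h s hs]⟩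

theorem IsCobd.pull {c : Cochain V n} (hc : IsCobd p Z c) {φ : W → V}
    (hp : ∀ w, p ∈ ZW w → p ∈ Z (φ w))
    (hφ : ∀ s : Fin (n + 1) → W, IsSimplex ZW s → IsSimplex Z (φ ∘ s)) :
    IsCobd p ZW (pull φ c) := by
  cases n with
  | zero => intro s hs; exact hc _ (hφ s hs)
  | succ n =>
    obtain ⟨b, hb, hcb⟩ := hc
    exact ⟨_, hb.pull hp, fun s hs => hcb _ (hφ s hs)⟩

theorem isSimplex_comp {φ : W → V} (h : ∀ w, ZW w ⊆ Z (φ w)) (s : Fin (n + 1) → W)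
    (hs : IsSimplex ZW s) : IsSimplex Z (φ ∘ s) :=
  hs.imp fun _ hy i => h _ (hy i)

theorem IsCobd.pull_of_subset {c : Cochain V n} (hc : IsCobd p Z c) {φ : W → V}
    (h : ∀ w, ZW w ⊆ Z (φ w)) : IsCobd p ZW (TupleCochain.pull φ c) :=
  hc.pull (fun w hw => h w hw) (isSimplex_comp h)

/-- A cochain map on full simplices that kills constants and is carried by a carrier compatible
with the nerves maps relative cocycles to coboundaries. -/
theorem isCobd_of_isCarried {T : ∀ n, Cochain V n →+ Cochain W n} {Car : Set W → Set V}
    (hT : ∀ n c, T (n + 1) (δ c) = δ (T n c)) (hconst : ∀ z : ℤ, T 0 (fun _ => z) = 0)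
    (hCar : Monotone Car) (hTc : ∀ n, IsCarried Car (T n))
    (hne : ∀ A : Set W, A.Nonempty → (Car A).Nonempty)
    (hs : ∀ {m n : ℕ} (s : Fin (n + 1) → W) (t : Fin (m + 1) → V),
      Set.range t ⊆ Car (Set.range s) → IsSimplex ZW s → IsSimplex Z t)
    (hp : ∀ A : Set W, (∀ w ∈ A, p ∈ ZW w) → ∀ v ∈ Car A, p ∈ Z v)
    {c : Cochain V n} (hc : IsRel p Z c) (hcoc : IsCocycle Z c) : IsCobd p ZW (T n c) := by
  -- Apexes chosen in the carrier make the homotopy at a simplex of `ZW` depend only on simplices of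
  -- `Z`, where δ c vanishes; so only the term δ (homotopy c) survives.
  choose a ha using fun (n : ℕ) (s : Fin (n + 1) → W) => hne _ (Set.range_nonempty s)
  have hloc := isCarried_homotopy hCar hTc ha
  cases n with
  | zero =>
    intro s hsS
    rw [← homotopy_δ_zero (a := a) hconst]
    exact hloc 0 _ _ fun t ht => hcoc t (hs s t ht hsS)
  | succ n =>
    refine ⟨homotopy T a n c, fun s hps => ?_, fun s hsS => ?_⟩
    · refine hloc n _ _ fun t ht => hc t fun i => ?_
      exact hp _ (by rintro _ ⟨i, rfl⟩; exact hps i) _ (ht ⟨i, rfl⟩)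
    · rw [← homotopy_δ_succ (a := a) hT hconst, Pi.add_apply,
        hloc (n + 1) _ _ fun t ht => hcoc t (hs s t ht hsS), zero_add]

/-- Contiguous maps induce the same map on cohomology. -/
theorem isCobd_pull_sub_pull {φ ψ : W → V} (hφ : ∀ w, ZW w ⊆ Z (φ w))
    (hψ : ∀ w, ZW w ⊆ Z (ψ w)) {c : Cochain V n} (hc : IsRel p Z c) (hcoc : IsCocycle Z c) :
    IsCobd p ZW (pull φ c - pull ψ c) := by
  -- The two images of a simplex of `ZW` together span a simplex of `Z`; their union is the carrier.
  refine isCobd_of_isCarried (T := fun n => pull φ - pull ψ)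
    (Car := fun A => φ '' A ∪ ψ '' A) (fun n c => ?_) (fun z => ?_) ?_ (fun n => ?_) ?_ ?_ ?_ hc hcoc
  · simp [pull_δ]
  · funext s
    simp [pull_apply]
  · exact fun A B h => Set.union_subset_union (Set.image_mono h) (Set.image_mono h)
  · refine IsCarried.sub (fun c s h => h _ ?_) (fun c s h => h _ ?_)
    · rw [Set.range_comp]; exact Set.subset_union_left
    · rw [Set.range_comp]; exact Set.subset_union_right
  · exact fun A hA => (hA.image φ).mono Set.subset_union_left
  · rintro m n s t ht ⟨y, hy⟩
    refine ⟨y, fun i => ?_⟩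
    rcases ht ⟨i, rfl⟩ with ⟨_, ⟨j, rfl⟩, h⟩ | ⟨_, ⟨j, rfl⟩, h⟩
    · exact h ▸ hφ _ (hy j)
    · exact h ▸ hψ _ (hy j)
  · rintro A hA v (⟨w, hw, rfl⟩ | ⟨w, hw, rfl⟩)
    · exact hφ _ (hA w hw)
    · exact hψ _ (hA w hw)

/-- Alternation only rearranges the vertices of a tuple, so the identity carrier works; constants
are killed in degree 0 because every 1-tuple is increasing. -/
theorem isCobd_sub_alt [LinearOrder V] {c : Cochain V n} (hc : IsRel p Z c)
    (hcoc : IsCocycle Z c) : IsCobd p Z (c - alt c) := by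
  refine isCobd_of_isCarried (T := fun n => AddMonoidHom.id _ - alt)
    (Car := fun A => A) (fun n c => ?_) (fun z => ?_) monotone_id (fun n => ?_)
    (fun A hA => hA) (fun s t ht hs => hs.of_range_subset ht) (fun A hA => hA) hc hcoc
  · simp [alt_δ]
  · funext s
    have hs : StrictMono s := fun i j h => absurd h (by simp [Subsingleton.elim (α := Fin 1) i j])
    simp [alt_apply_of_strictMono (fun _ => z) hs]
  · exact IsCarried.sub (fun c s h => h _ subset_rfl) (fun c s h => alt_eq_zero h)

/-- An alternating coboundary is the coboundary of an alternating cochain. -/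
theorem IsCobd.exists_isAlt {c : Cochain V (n + 1)} (hc : IsCobd p Z c) (halt : IsAlt c) :
    ∃ b, IsRel p Z b ∧ IsAlt b ∧ ∀ s, IsSimplex Z s → c s = δ b s := by
  let _ : LinearOrder V := IsWellOrder.linearOrder WellOrderingRel
  obtain ⟨b, hb, h⟩ := hc
  refine ⟨alt b, hb.alt, isAlt_alt b, fun s hs => ?_⟩
  rw [← alt_δ, ← sub_eq_zero, ← halt.alt_eq, ← Pi.sub_apply, ← map_sub]
  -- All tuples with vertices among those of `s` are simplices, so `c - δ b` vanishes on them and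
  -- its alternation vanishes at `s`.
  refine alt_eq_zero fun t ht => ?_
  rw [Pi.sub_apply, h t (hs.of_range_subset ht), sub_self]

end Nerve

/-! ## Freeness of groups of finite-valued functions -/

namespace Submodule

variable {R : Type*} [CommRing R]

/-- The ideal of coefficients at `i` of the elements of `N` that are supported on `{j | j ≤ i}`. -/
noncomputable def leadingIdeal {I : Type*} [LinearOrder I] (N : Submodule R (I →₀ R)) (i : I) : Ideal R :=
  (N ⊓ ⨅ j : Set.Ioi i, LinearMap.ker (Finsupp.lapply (R := R) (M := R) j.1)).map
    (Finsupp.lapply i)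

theorem mem_leadingIdeal {I : Type*} [LinearOrder I] {N : Submodule R (I →₀ R)} {i : I} {r : R} :
    r ∈ N.leadingIdeal i ↔ ∃ x ∈ N, (∀ j, i < j → x j = 0) ∧ x i = r := by
  simp [leadingIdeal, and_assoc]

variable [IsDomain R] [IsPrincipalIdealRing R]

/-- For each `i` choose `x i ∈ N`, supported in indices at most `i`, whose coefficient at `i`
generates the leading ideal. Those with nonzero generator form a basis: the largest index of a
relation gives independence, and subtracting a multiple of `x i` lowers the leading index, so
well-founded induction gives spanning. -/
theorem free_of_finsupp {I : Type*} [LinearOrder I] [WellFoundedLT I]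
    (N : Submodule R (I →₀ R)) : Module.Free R N := by
  classical
  let g : I → R := fun i => Submodule.IsPrincipal.generator (N.leadingIdeal i)
  have hg : ∀ i, ∃ x ∈ N, (∀ j, i < j → x j = 0) ∧ x i = g i := fun i =>
    mem_leadingIdeal.1 (Submodule.IsPrincipal.generator_mem _)
  choose x hxN hx0 hxi using hg
  let b : {i // g i ≠ 0} → (I →₀ R) := fun i => x i
  have hli : LinearIndependent R b := by
    rw [linearIndependent_iff]
    intro l hl
    by_contra hne
    have hs : l.support.Nonempty := Finsupp.support_nonempty_iff.2 hne
    set m := l.support.max' hs with hm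
    have hev := DFunLike.congr_fun hl m.1
    rw [Finsupp.linearCombination_apply, Finsupp.sum, Finsupp.finsetSum_apply,
      Finset.sum_eq_single m] at hev
    · simp only [Finsupp.smul_apply, b, hxi, smul_eq_mul, Finsupp.coe_zero, Pi.zero_apply,
        mul_eq_zero] at hev
      rcases hev with h | h
      · exact Finsupp.mem_support_iff.1 (l.support.max'_mem hs) h
      · exact m.2 h
    · intro i hi hne
      have : i < m := lt_of_le_of_ne (l.support.le_max' i hi) hne
      simp [b, hx0 i.1 m.1 this]
    · intro h
      exact absurd (l.support.max'_mem hs) h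
  have hspan : ∀ i, ∀ y ∈ N, (∀ j, i < j → y j = 0) → y ∈ span R (Set.range b) := by
    intro i
    induction i using WellFoundedLT.induction with
    | ind i ih =>
      have hlt : ∀ y ∈ N, (∀ j, i ≤ j → y j = 0) → y ∈ span R (Set.range b) := by
        intro y hy hyi
        by_cases h0 : y = 0
        · rw [h0]; exact zero_mem _
        · have hs : y.support.Nonempty := Finsupp.support_nonempty_iff.2 h0
          have hmem := y.support.max'_mem hs
          refine ih (y.support.max' hs) ?_ y hy fun j hj => ?_
          · by_contra hle
            exact Finsupp.mem_support_iff.1 hmem (hyi _ (not_lt.1 hle))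
          · by_contra hne
            exact absurd (y.support.le_max' j (Finsupp.mem_support_iff.2 hne)) (not_le.2 hj)
      intro y hy hyi
      have hmem : y i ∈ N.leadingIdeal i := mem_leadingIdeal.2 ⟨y, hy, hyi, rfl⟩
      obtain ⟨r, hr⟩ := (Submodule.IsPrincipal.mem_iff_eq_smul_generator _).1 hmem
      have hr' : y i = r * g i := hr
      by_cases hgi : g i = 0
      · refine hlt y hy fun j hj => ?_
        rcases hj.eq_or_lt with rfl | hj
        · rw [hr', hgi, mul_zero]
        · exact hyi j hj
      · have hxs : x i ∈ span R (Set.range b) := subset_span ⟨⟨i, hgi⟩, rfl⟩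
        rw [← sub_add_cancel y (r • x i)]
        refine add_mem (hlt _ (sub_mem hy (N.smul_mem r (hxN i))) fun j hj => ?_)
          (smul_mem _ r hxs)
        rcases hj.eq_or_lt with rfl | hj
        · simp [hr', hxi]
        · simp [hyi j hj, hx0 i j hj]
  have hN : span R (Set.range b) = N := by
    refine le_antisymm (span_le.2 ?_) fun y hy => ?_
    · rintro _ ⟨i, rfl⟩
      exact hxN i
    · by_cases h0 : y = 0
      · rw [h0]; exact zero_mem _
      · refine hspan (y.support.max' (Finsupp.support_nonempty_iff.2 h0)) y hy fun j hj => ?_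
        by_contra hne
        exact absurd (y.support.le_max' j (Finsupp.mem_support_iff.2 hne)) (not_le.2 hj)
  rw [← hN]
  exact Module.Free.of_basis (Module.Basis.span hli)

/-- A submodule of a free module over a principal ideal domain is free. -/
theorem free_of_free {M : Type*} [AddCommGroup M] [Module R M] [Module.Free R M]
    (N : Submodule R M) : Module.Free R N := by
  let I := Module.Free.ChooseBasisIndex R M
  let _ : LinearOrder I := IsWellOrder.linearOrder WellOrderingRel
  have : WellFoundedLT I := ⟨(inferInstance : IsWellFounded I WellOrderingRel).wf⟩
  let e := (Module.Free.chooseBasis R M).repr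
  have := free_of_finsupp (N.map e.toLinearMap)
  exact Module.Free.of_equiv (e.submoduleMap N).symm

end Submodule

/-- A module over a principal ideal domain that embeds into a free module is free. -/
theorem Module.Free.of_injective {R M N : Type*} [CommRing R] [IsDomain R]
    [IsPrincipalIdealRing R] [AddCommGroup M] [Module R M] [AddCommGroup N] [Module R N]
    [Module.Free R N] (f : M →ₗ[R] N) (hf : Function.Injective f) : Module.Free R M :=
  have := Submodule.free_of_free (LinearMap.range f)
  Module.Free.of_equiv (LinearEquiv.ofInjective f hf).symm

/-! ### Finite-valued integral functions, extended to ultrafilters -/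

section FiniteValued

variable {S : Type u}

theorem Ultrafilter.exists_preimage_singleton_mem {L : Type*} (u : Ultrafilter S) {f : S → L}
    (hf : (Set.range f).Finite) : ∃ l, f ⁻¹' {l} ∈ u := by
  have h : (⋃ l ∈ Set.range f, f ⁻¹' {l}) ∈ u := Filter.univ_mem' fun x => by simp
  obtain ⟨l, -, hl⟩ := (Ultrafilter.finite_biUnion_mem_iff hf).1 h
  exact ⟨l, hl⟩

theorem Ultrafilter.eq_of_preimage_singleton_mem {L : Type*} {u : Ultrafilter S} {f : S → L}
    {l l' : L} (h : f ⁻¹' {l} ∈ u) (h' : f ⁻¹' {l'} ∈ u) : l = l' := by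
  obtain ⟨x, hx, hxl⟩ := u.nonempty_of_mem (Filter.inter_mem h h')
  exact hx.symm.trans hxl

/-- The extension of a finite-valued function to the space of ultrafilters. -/
noncomputable def ultrafilterExtend {f : S → ℤ} (hf : (Set.range f).Finite) :
    LocallyConstant (Ultrafilter S) ℤ where
  toFun u := (u.exists_preimage_singleton_mem hf).choose
  isLocallyConstant := by
    rw [IsLocallyConstant.iff_exists_open]
    intro u
    refine ⟨{w | f ⁻¹' {(u.exists_preimage_singleton_mem hf).choose} ∈ w},
      ultrafilter_isOpen_basic _, (u.exists_preimage_singleton_mem hf).choose_spec,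
      fun w hw => Ultrafilter.eq_of_preimage_singleton_mem
        (w.exists_preimage_singleton_mem hf).choose_spec hw⟩

theorem ultrafilterExtend_apply {f : S → ℤ} (hf : (Set.range f).Finite) {u : Ultrafilter S}
    {z : ℤ} (h : f ⁻¹' {z} ∈ u) : ultrafilterExtend hf u = z :=
  Ultrafilter.eq_of_preimage_singleton_mem (u.exists_preimage_singleton_mem hf).choose_spec h

theorem ultrafilterExtend_pure {f : S → ℤ} (hf : (Set.range f).Finite) (x : S) :
    ultrafilterExtend hf (pure x) = f x :=
  ultrafilterExtend_apply hf (show x ∈ f ⁻¹' {f x} from rfl)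

/-- A group of finite-valued integral functions is free. -/
theorem free_of_finite_range (A : AddSubgroup (S → ℤ)) (hA : ∀ f ∈ A, (Set.range f).Finite) :
    Module.Free ℤ A := by
  -- Nöbeling's theorem, applied to the profinite space of ultrafilters on `S`.
  have hfree : Module.Free ℤ (LocallyConstant (Ultrafilter S) ℤ) := by
    convert LocallyConstant.freeOfProfinite (Profinite.of (Ultrafilter S))
  let e : A →+ LocallyConstant (Ultrafilter S) ℤ :=
    { toFun := fun f => ultrafilterExtend (hA f.1 f.2)
      map_zero' := LocallyConstant.ext fun u =>
        ultrafilterExtend_apply _ (Filter.univ_mem' fun x => by simp)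
      map_add' := fun f g => LocallyConstant.ext fun u => by
        obtain ⟨a, ha⟩ := u.exists_preimage_singleton_mem (hA f.1 f.2)
        obtain ⟨b, hb⟩ := u.exists_preimage_singleton_mem (hA g.1 g.2)
        rw [LocallyConstant.add_apply]
        erw [ultrafilterExtend_apply _ ha, ultrafilterExtend_apply _ hb]
        refine ultrafilterExtend_apply _ (Filter.mem_of_superset (Filter.inter_mem ha hb) ?_)
        rintro x ⟨hx, hx'⟩
        have h1 : f.1 x = a := hx
        have h2 : g.1 x = b := hx'
        simp [h1, h2] }
  -- Principal ultrafilters recover the original function, so extension is injective.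
  refine Module.Free.of_injective e.toIntLinearMap fun f g h => Subtype.ext (funext fun x => ?_)
  have h' : ultrafilterExtend (hA f.1 f.2) = ultrafilterExtend (hA g.1 g.2) := h
  rw [← ultrafilterExtend_pure (hA f.1 f.2), h', ultrafilterExtend_pure]

end FiniteValued

/-! ## Simple alternating cochains on ultrafilters with a common limit -/

namespace UltraCochain

open TupleCochain Nerve Topology

variable {Y : Type u} {n : ℕ}

open Classical in
/-- The incidence matrix of a tuple of sets and a tuple of ultrafilters. -/
noncomputable def incidence (E : Fin (n + 1) → Set Y) (s : Fin (n + 1) → Ultrafilter Y) :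
    Matrix (Fin (n + 1)) (Fin (n + 1)) ℤ :=
  Matrix.of fun i j => if E i ∈ s j then 1 else 0

theorem incidence_of_mem {E : Fin (n + 1) → Set Y} {s : Fin (n + 1) → Ultrafilter Y}
    {i j : Fin (n + 1)} (h : E i ∈ s j) : incidence E s i j = 1 := if_pos h

theorem incidence_of_notMem {E : Fin (n + 1) → Set Y} {s : Fin (n + 1) → Ultrafilter Y}
    {i j : Fin (n + 1)} (h : E i ∉ s j) : incidence E s i j = 0 := if_neg h

theorem incidence_congr {E E' : Fin (n + 1) → Set Y} {s s' : Fin (n + 1) → Ultrafilter Y}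
    {i j i' j' : Fin (n + 1)} (h : E i ∈ s j ↔ E' i' ∈ s' j') :
    incidence E s i j = incidence E' s' i' j' := by
  by_cases h1 : E i ∈ s j
  · rw [incidence_of_mem h1, incidence_of_mem (h.1 h1)]
  · rw [incidence_of_notMem h1, incidence_of_notMem fun h2 => h1 (h.2 h2)]

variable [TopologicalSpace Y]

variable (Y) in
/-- The tuples of ultrafilters that have a common limit. -/
abbrev Point (n : ℕ) : Type u :=
  {s : Fin (n + 1) → Ultrafilter Y // ∃ y, ∀ i, (s i : Filter Y) ≤ 𝓝 y}

/-- The `i`-th face. -/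
def Point.face (s : Point Y (n + 1)) (i : Fin (n + 2)) : Point Y n :=
  ⟨s.1 ∘ i.succAbove, s.2.imp fun _ hy _ => hy _⟩

/-- The coboundary operator on functions of tuples of ultrafilters. -/
def coboundary : (Point Y n → ℤ) →+ (Point Y (n + 1) → ℤ) where
  toFun F s := ∑ i : Fin (n + 2), (-1) ^ (i : ℕ) * F (s.face i)
  map_zero' := funext fun s => by simp
  map_add' c d := funext fun s => by simp [mul_add, Finset.sum_add_distrib]

theorem coboundary_apply (F : Point Y n → ℤ) (s : Point Y (n + 1)) :
    coboundary F s = ∑ i : Fin (n + 2), (-1) ^ (i : ℕ) * F (s.face i) := rfl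

theorem coboundary_eq {F : Point Y n → ℤ} {c : Cochain (Ultrafilter Y) n}
    (h : ∀ s : Point Y n, F s = c s.1) (s : Point Y (n + 1)) : coboundary F s = δ c s.1 := by
  rw [coboundary_apply, δ_apply]
  exact Finset.sum_congr rfl fun i _ => by rw [h]; rfl

theorem coboundary_coboundary (F : Point Y n → ℤ) : coboundary (coboundary F) = 0 := by
  classical
  let c : Cochain (Ultrafilter Y) n := fun s =>
    if h : ∃ y, ∀ i, (s i : Filter Y) ≤ 𝓝 y then F ⟨s, h⟩ else 0
  have hc : ∀ s : Point Y n, F s = c s.1 := fun s => by simp only [c, dif_pos s.2]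
  funext s
  rw [coboundary_eq (coboundary_eq hc), δ_δ]
  rfl

/-- The alternating function on tuples of ultrafilters given by a tuple of sets. -/
noncomputable def detFun (E : Fin (n + 1) → Set Y) : Point Y n → ℤ :=
  fun s => (incidence E s.1).det

theorem mem_closure_of_mem {E : Set Y} {u : Ultrafilter Y} {y : Y} (hE : E ∈ u)
    (hu : (u : Filter Y) ≤ 𝓝 y) : y ∈ closure E :=
  mem_closure_iff_ultrafilter.2 ⟨u, hE, hu⟩

/-- No ultrafilter converging to `y` contains `E i`, so row `i` is zero. -/
theorem detFun_eq_zero {E : Fin (n + 1) → Set Y} {s : Point Y n} {y : Y}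
    (hy : ∀ i, (s.1 i : Filter Y) ≤ 𝓝 y) {i : Fin (n + 1)} (hi : y ∉ closure (E i)) :
    detFun E s = 0 :=
  Matrix.det_eq_zero_of_row_eq_zero i fun j => if_neg fun h => hi (mem_closure_of_mem h (hy j))

/-- If the common limit lies in `U`, then the open set `U` belongs to every ultrafilter of the
tuple, and the coboundary is the Laplace expansion along the resulting row of ones. Otherwise the
limit is outside the closures of the `E i` and both sides vanish. -/
theorem coboundary_detFun (E : Fin (n + 1) → Set Y) {U : Set Y} (hU : IsOpen U)
    (hEU : ∀ i, closure (E i) ⊆ U) : coboundary (detFun E) = detFun (Fin.cons U E) := by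
  funext s
  obtain ⟨y, hy⟩ := s.2
  by_cases hyU : y ∈ U
  · have hmem : ∀ j, U ∈ s.1 j := fun j => hy j (hU.mem_nhds hyU)
    rw [detFun, Matrix.det_succ_row_zero, coboundary_apply]
    refine Finset.sum_congr rfl fun i _ => ?_
    have h1 : incidence (Fin.cons U E) s.1 0 i = 1 := if_pos (hmem i)
    rw [h1, mul_one]
    rfl
  · rw [detFun_eq_zero hy (i := Fin.succ 0) (fun h => hyU (hEU 0 (by simpa using h))),
      coboundary_apply]
    refine Finset.sum_eq_zero fun i _ => ?_
    rw [detFun_eq_zero (E := E) (s := s.face i) (y := y) (fun j => hy _) (i := 0)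
      (fun h => hyU (hEU 0 h)), mul_zero]

variable (p : Y)

variable (n) in
/-- The group of cochains generated by the functions `detFun E`, for tuples `E` of sets whose
closures do not contain `p`. -/
def cochains : AddSubgroup (Point Y n → ℤ) :=
  AddSubgroup.closure {F | ∃ E : Fin (n + 1) → Set Y, (∀ i, p ∉ closure (E i)) ∧ F = detFun E}

/-- The closures of the fibres of a map. -/
abbrev fibreClosure {L : Type*} (ρ : Y → L) : L → Set Y :=
  fun l => closure (Set.preimage ρ {l})

/-- `F` is the pullback of the cochain `a` under the labelling `ρ`. -/
def IsPull {L : Type*} (ρ : Y → L) (a : Cochain L n) (F : Point Y n → ℤ) : Prop :=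
  ∀ (s : Point Y n) (t : Fin (n + 1) → L), (∀ i, ρ ⁻¹' {t i} ∈ s.1 i) → F s = a t

variable {p}

theorem detFun_mem {E : Fin (n + 1) → Set Y} (h : ∀ i, p ∉ closure (E i)) :
    detFun E ∈ cochains n p := AddSubgroup.subset_closure ⟨E, h, rfl⟩

theorem exists_isOpen_superset [T2Space Y] [CompactSpace Y] {E : Set Y} (hp : p ∉ closure E) :
    ∃ U, IsOpen U ∧ closure E ⊆ U ∧ p ∉ closure U := by
  obtain ⟨U, hU, hEU, hUp⟩ := normal_exists_closure_subset isClosed_closure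
    (isClosed_singleton (x := p)).isOpen_compl (Set.subset_compl_singleton_iff.2 hp)
  exact ⟨U, hU, hEU, fun h => hUp h rfl⟩

/-- One set away from `p` is enough. All sets may be cut down to an open neighbourhood `U` of its
closure with `p ∉ closure U`: tuples with limit in `U` do not notice the cut, and at the others both
determinants vanish. -/
theorem detFun_mem_of_exists [T2Space Y] [CompactSpace Y] {E : Fin (n + 1) → Set Y}
    (h : ∃ i, p ∉ closure (E i)) : detFun E ∈ cochains n p := by
  obtain ⟨i, hi⟩ := h
  obtain ⟨U, hU, hEU, hUp⟩ := exists_isOpen_superset hi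
  suffices detFun E = detFun fun j => E j ∩ U by
    rw [this]
    exact detFun_mem fun j hj => hUp (closure_mono Set.inter_subset_right hj)
  funext s
  obtain ⟨y, hy⟩ := s.2
  by_cases hyU : y ∈ U
  · have hmem : ∀ j, U ∈ s.1 j := fun j => hy j (hU.mem_nhds hyU)
    rw [detFun, detFun]
    congr 1
    ext j k
    exact incidence_congr ⟨fun h => Filter.inter_mem h (hmem k),
      fun h => Filter.mem_of_superset h Set.inter_subset_left⟩
  · rw [detFun_eq_zero hy (fun h => hyU (hEU h)), detFun_eq_zero hy (i := i)
      (fun h => hyU (hEU (closure_mono Set.inter_subset_left h)))]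

/-- A tuple of labels whose fibres have a common limit point lifts to a tuple of ultrafilters. -/
theorem exists_point {L : Type*} {ρ : Y → L} {t : Fin (n + 1) → L}
    (ht : IsSimplex (fibreClosure ρ) t) : ∃ s : Point Y n, ∀ i, ρ ⁻¹' {t i} ∈ s.1 i := by
  obtain ⟨y, hy⟩ := ht
  choose s hs hsy using fun i => mem_closure_iff_ultrafilter.1 (hy i)
  exact ⟨⟨s, y, hsy⟩, hs⟩

theorem exists_label {L : Type*} {ρ : Y → L} (hρ : (Set.range ρ).Finite) (s : Point Y n) :
    ∃ t : Fin (n + 1) → L, ∀ i, ρ ⁻¹' {t i} ∈ s.1 i := by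
  choose t ht using fun i => (s.1 i).exists_preimage_singleton_mem hρ
  exact ⟨t, ht⟩

theorem isSimplex_label {L : Type*} {ρ : Y → L} {s : Point Y n} {t : Fin (n + 1) → L}
    (h : ∀ i, ρ ⁻¹' {t i} ∈ s.1 i) : IsSimplex (fibreClosure ρ) t :=
  s.2.imp fun _ hy i => mem_closure_of_mem (h i) (hy i)

theorem IsPull.coboundary {L : Type*} {ρ : Y → L} {a : Cochain L n} {F : Point Y n → ℤ}
    (h : IsPull ρ a F) : IsPull ρ (δ a) (coboundary F) := fun s t ht => by
  rw [coboundary_apply, δ_apply]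
  exact Finset.sum_congr rfl fun i _ => by rw [h (s.face i) (t ∘ i.succAbove) fun j => ht _]

theorem IsPull.add {L : Type*} {ρ : Y → L} {a b : Cochain L n} {F F' : Point Y n → ℤ}
    (h : IsPull ρ a F) (h' : IsPull ρ b F') : IsPull ρ (a + b) (F + F') := fun s t ht => by
  simp [h s t ht, h' s t ht]

theorem IsPull.sub {L : Type*} {ρ : Y → L} {a b : Cochain L n} {F F' : Point Y n → ℤ}
    (h : IsPull ρ a F) (h' : IsPull ρ b F') : IsPull ρ (a - b) (F - F') := fun s t ht => by
  simp [h s t ht, h' s t ht]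

theorem IsPull.neg {L : Type*} {ρ : Y → L} {a : Cochain L n} {F : Point Y n → ℤ}
    (h : IsPull ρ a F) : IsPull ρ (-a) (-F) := fun s t ht => by
  simp [h s t ht]

theorem IsPull.comp {L M : Type*} {ρ : Y → L} {τ : Y → M} {a : Cochain L n} {F : Point Y n → ℤ}
    (h : IsPull ρ a F) (q : M → L) (hq : q ∘ τ = ρ) : IsPull τ (pull q a) F := fun s t ht =>
  h s (q ∘ t) fun i => Filter.mem_of_superset (ht i) fun y hy => by
    subst hq; exact congrArg q hy

theorem fibreClosure_subset {L M : Type*} {ρ : Y → L} {τ : Y → M} (q : M → L) (hq : q ∘ τ = ρ)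
    (m : M) : fibreClosure τ m ⊆ fibreClosure ρ (q m) :=
  closure_mono fun y hy => by subst hq; exact congrArg q hy

theorem exists_isPull_detFun {E : Fin (n + 1) → Set Y} (hE : ∀ i, p ∉ closure (E i)) :
    ∃ (L : Type u) (_ : Finite L) (ρ : Y → L) (a : Cochain L n),
      IsAlt a ∧ IsRel p (fibreClosure ρ) a ∧ IsPull ρ a (detFun E) := by
  classical
  -- A point is labelled by the list of the sets `E i` that contain it; this list determines the
  -- corresponding column of the incidence matrix.
  refine ⟨ULift (Fin (n + 1) → Prop), inferInstance, fun y => ⟨fun i => y ∈ E i⟩,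
    fun t => (Matrix.of fun i j => if (t j).down i then (1 : ℤ) else 0).det, ?_, ?_, ?_⟩
  · intro t σ
    have h := Matrix.det_permute' σ (Matrix.of fun i j => if (t j).down i then (1 : ℤ) else 0)
    rw [Int.cast_id] at h
    exact h
  · intro t ht
    refine Matrix.det_eq_zero_of_column_eq_zero 0 fun i => if_neg fun h => hE i ?_
    refine closure_mono (fun y hy => ?_) (ht 0)
    have hy' : (⟨fun i => y ∈ E i⟩ : ULift (Fin (n + 1) → Prop)) = t 0 := hy
    rw [← hy'] at h
    exact h
  · intro s t ht
    rw [detFun]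
    congr 1
    ext i j
    simp only [incidence, Matrix.of_apply]
    congr 1
    refine propext ⟨fun h => ?_, fun h => Filter.mem_of_superset (ht j) fun y hy => ?_⟩
    · obtain ⟨y, hy, hyE⟩ := (s.1 j).nonempty_of_mem (Filter.inter_mem (ht j) h)
      have hy' : (⟨fun i => y ∈ E i⟩ : ULift (Fin (n + 1) → Prop)) = t j := hy
      rw [← hy']
      exact hyE
    · have hy' : (⟨fun i => y ∈ E i⟩ : ULift (Fin (n + 1) → Prop)) = t j := hy
      rw [← hy'] at h
      exact h

/-- Every cochain is the pullback of an alternating relative cochain under a finite labelling. -/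
theorem exists_isPull {F : Point Y n → ℤ} (hF : F ∈ cochains n p) :
    ∃ (L : Type u) (_ : Finite L) (ρ : Y → L) (a : Cochain L n),
      IsAlt a ∧ IsRel p (fibreClosure ρ) a ∧ IsPull ρ a F := by
  induction hF using AddSubgroup.closure_induction with
  | mem F hF =>
    obtain ⟨E, hE, rfl⟩ := hF
    exact exists_isPull_detFun hE
  | zero =>
    exact ⟨PUnit, inferInstance, fun _ => ⟨⟩, 0, IsAlt.zero, fun _ _ => rfl, fun _ _ _ => rfl⟩
  | add F F' _ _ h h' =>
    obtain ⟨L, _, ρ, a, ha, har, hF⟩ := h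
    obtain ⟨L', _, ρ', a', ha', har', hF'⟩ := h'
    let τ : Y → L × L' := fun y => (ρ y, ρ' y)
    refine ⟨L × L', inferInstance, τ, pull Prod.fst a + pull Prod.snd a',
      (ha.pull _).add (ha'.pull _), ?_, (hF.comp (τ := τ) Prod.fst rfl).add
        (hF'.comp (τ := τ) Prod.snd rfl)⟩
    exact (har.pull fun w hw => fibreClosure_subset (τ := τ) Prod.fst rfl w hw).add
      (har'.pull fun w hw => fibreClosure_subset (τ := τ) Prod.snd rfl w hw)
  | neg F _ h =>
    obtain ⟨L, _, ρ, a, ha, har, hF⟩ := h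
    exact ⟨L, ‹_›, ρ, -a, ha.neg, fun s hs => by simp [har s hs], hF.neg⟩

theorem finite_range_of_mem {F : Point Y n → ℤ} (hF : F ∈ cochains n p) :
    (Set.range F).Finite := by
  obtain ⟨L, _, ρ, a, -, -, h⟩ := exists_isPull hF
  refine (Set.finite_range a).subset ?_
  rintro _ ⟨s, rfl⟩
  obtain ⟨t, ht⟩ := exists_label (Set.toFinite (Set.range ρ)) s
  exact ⟨t, (h s t ht).symm⟩

instance free_cochains : Module.Free ℤ (cochains n p) :=
  free_of_finite_range _ fun _ => finite_range_of_mem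

theorem eq_of_strictMono_of_range_subset {L : Type*} [LinearOrder L] {k : ℕ} {T t : Fin k → L}
    (hT : StrictMono T) (ht : StrictMono t) (h : Set.range T ⊆ Set.range t) : T = t := by
  refine (hT.range_inj ht).1 (Set.eq_of_subset_of_ncard_le h ?_ (Set.finite_range t))
  rw [← Set.image_univ, ← Set.image_univ, Set.ncard_image_of_injective _ hT.injective,
    Set.ncard_image_of_injective _ ht.injective]

open Classical in
-- As functions of `t`, these determinants are alternating, and on increasing tuples they are the
-- indicator functions of the single tuples `T`.
theorem IsAlt.eq_sum_det {L : Type*} [LinearOrder L] [Fintype L] {a : Cochain L n}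
    (ha : IsAlt a) (t : Fin (n + 1) → L) :
    a t = ∑ T : Fin (n + 1) → L with StrictMono T,
      a T * (Matrix.of fun i j => if T i = t j then (1 : ℤ) else 0).det := by
  refine congrFun (ha.ext (d := fun t => ∑ T : Fin (n + 1) → L with StrictMono T,
      a T * (Matrix.of fun i j => if T i = t j then (1 : ℤ) else 0).det) ?_ ?_) t
  · intro t σ
    simp only [Finset.mul_sum]
    refine Finset.sum_congr rfl fun T _ => ?_
    have h := Matrix.det_permute' σ (Matrix.of fun i j => if T i = t j then (1 : ℤ) else 0)
    rw [Int.cast_id] at h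
    rw [mul_left_comm, ← h]
    rfl
  · intro t ht
    rw [Finset.sum_eq_single t]
    · have : (Matrix.of fun i j => if t i = t j then (1 : ℤ) else 0) = 1 := by
        ext i j
        simp [Matrix.one_apply, ht.injective.eq_iff]
      rw [this, Matrix.det_one, mul_one]
    · intro T hT hne
      have hT' : StrictMono T := (Finset.mem_filter.1 hT).2
      have : ¬ Set.range T ⊆ Set.range t := fun h =>
        hne (eq_of_strictMono_of_range_subset hT' ht h)
      obtain ⟨_, ⟨i, rfl⟩, hi⟩ := Set.not_subset.1 this
      rw [Matrix.det_eq_zero_of_row_eq_zero i fun j => if_neg fun h => hi ⟨j, h.symm⟩, mul_zero]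
    · intro h
      exact absurd (Finset.mem_filter.2 ⟨Finset.mem_univ _, ht⟩) h

/-- The pullback of `IsAlt.eq_sum_det` writes `F` as a combination of determinants of fibres. If all
fibres of `T` have `p` in their closure, the coefficient `a T` is zero because `a` is relative;
otherwise `detFun_mem_of_exists` applies. -/
theorem mem_of_isPull [T2Space Y] [CompactSpace Y] {L : Type*} [Finite L] {ρ : Y → L}
    {a : Cochain L n} {F : Point Y n → ℤ} (ha : IsAlt a) (har : IsRel p (fibreClosure ρ) a)
    (hF : IsPull ρ a F) : F ∈ cochains n p := by
  classical
  have := Fintype.ofFinite L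
  let _ : LinearOrder L := IsWellOrder.linearOrder WellOrderingRel
  have : F = ∑ T : Fin (n + 1) → L with StrictMono T, a T • detFun fun i => ρ ⁻¹' {T i} := by
    funext s
    obtain ⟨t, ht⟩ := exists_label (Set.toFinite (Set.range ρ)) s
    rw [hF s t ht, IsAlt.eq_sum_det ha t, Finset.sum_apply]
    refine Finset.sum_congr rfl fun T _ => ?_
    rw [Pi.smul_apply, smul_eq_mul, detFun]
    congr 2
    ext i j
    simp only [incidence, Matrix.of_apply]
    congr 1
    refine propext ⟨fun h => h ▸ ht j, fun h => Ultrafilter.eq_of_preimage_singleton_mem h (ht j)⟩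
  rw [this]
  refine sum_mem fun T _ => ?_
  by_cases hT : ∃ i, p ∉ fibreClosure ρ (T i)
  · exact zsmul_mem (detFun_mem_of_exists hT) _
  · rw [har T (by simpa using hT), zero_smul]
    exact zero_mem _

theorem coboundary_mem [T2Space Y] [CompactSpace Y] {F : Point Y n → ℤ} (hF : F ∈ cochains n p) :
    coboundary F ∈ cochains (n + 1) p := by
  obtain ⟨L, _, ρ, a, ha, har, h⟩ := exists_isPull hF
  refine mem_of_isPull ha.δ (fun s hs => ?_) h.coboundary
  rw [δ_apply]
  refine Finset.sum_eq_zero fun i _ => ?_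
  rw [har (s ∘ i.succAbove) fun j => hs _, mul_zero]

end UltraCochain

/-! ## Kolmogoroff chains as homomorphisms -/

/-! ### Multiadditive functions of finite sets -/

section Multiadditive

variable {Λ : Type*} {G : Type*} [AddCommGroup G]

theorem map_update_empty_of_additive [DecidableEq Λ] {k : ℕ} {P : (Fin k → Finset Λ) → G}
    (hP : ∀ J i (A B : Finset Λ), Disjoint A B →
      P (Function.update J i (A ∪ B)) = P (Function.update J i A) + P (Function.update J i B))
    (J : Fin k → Finset Λ) (i : Fin k) : P (Function.update J i ∅) = 0 := by
  have := hP J i ∅ ∅ (Finset.disjoint_empty_left _)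
  simpa using this

/-- A function of finite sets that is additive in each variable is determined by its values on
singletons. -/
theorem eq_sum_singletons_of_additive [Fintype Λ] [DecidableEq Λ] {k : ℕ}
    {P : (Fin k → Finset Λ) → G}
    (hP : ∀ J i (A B : Finset Λ), Disjoint A B →
      P (Function.update J i (A ∪ B)) = P (Function.update J i A) + P (Function.update J i B))
    (J : Fin k → Finset Λ) :
    P J = ∑ t : Fin k → Λ, if ∀ i, t i ∈ J i then P fun i => {t i} else 0 := by
  induction k with
  | zero =>
    rw [Fintype.sum_unique, if_pos fun i => i.elim0]
    exact congrArg P (Subsingleton.elim _ _)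
  | succ k ih =>
    have hcons : ∀ (A : Finset Λ) (J' : Fin k → Finset Λ),
        P (Fin.cons A J') = ∑ l ∈ A, P (Fin.cons {l} J') := by
      intro A J'
      induction A using Finset.induction_on with
      | empty =>
        rw [Finset.sum_empty, ← map_update_empty_of_additive hP (Fin.cons ∅ J') 0,
          Fin.update_cons_zero]
      | insert l A hl ihA =>
        have := hP (Fin.cons ∅ J') 0 {l} A (by simpa using hl)
        simp only [Fin.update_cons_zero] at this
        rw [Finset.insert_eq, this, ← Finset.insert_eq, Finset.sum_insert hl, ihA]
    rw [← Fin.cons_self_tail J, hcons, ← (Fin.consEquiv fun _ => Λ).sum_comp,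
      Fintype.sum_prod_type]
    rw [← Finset.sum_subset (Finset.subset_univ (J 0))]
    · refine Finset.sum_congr rfl fun l hl => ?_
      rw [ih (P := fun J' => P (Fin.cons {l} J'))]
      · refine Finset.sum_congr rfl fun t _ => ?_
        have : (fun i => {(Fin.cons l t : Fin (k + 1) → Λ) i} : Fin (k + 1) → Finset Λ) =
            Fin.cons {l} fun i => {t i} := by
          funext i
          refine Fin.cases ?_ (fun i => ?_) i <;> simp
        exact if_congr (by simp [Fin.consEquiv, Fin.forall_fin_succ, hl, Fin.tail]) (congrArg P this.symm) rfl
      · intro J' i A B hAB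
        simp only [Fin.cons_update]
        exact hP _ _ A B hAB
    · intro l _ hl
      refine Finset.sum_eq_zero fun t _ => if_neg fun h => hl ?_
      simpa [Fin.consEquiv] using h 0

open Classical in
-- Sorting writes each injective tuple uniquely as an increasing tuple composed with a permutation.
theorem sum_eq_sum_strictMono_sum_perm [Fintype Λ] [LinearOrder Λ] {k : ℕ}
    (h : (Fin k → Λ) → G) (h0 : ∀ t, ¬ Function.Injective t → h t = 0) :
    ∑ t, h t = ∑ T : Fin k → Λ with StrictMono T, ∑ σ : Equiv.Perm (Fin k), h (T ∘ σ) := by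
  rw [← Finset.sum_product']
  rw [← Finset.sum_filter_of_ne (p := Function.Injective) fun t _ ht => by
    by_contra hi; exact ht (h0 t hi)]
  symm
  refine Finset.sum_bij' (fun q _ => q.1 ∘ q.2) (fun t _ => (t ∘ Tuple.sort t, (Tuple.sort t)⁻¹))
    ?_ ?_ ?_ ?_ ?_
  · rintro ⟨T, σ⟩ hT
    have hT' : StrictMono T := by simpa using hT
    simpa using hT'.injective
  · intro t ht
    have ht' : Function.Injective t := by simpa using ht
    simpa using (Tuple.monotone_sort t).strictMono_of_injective
      (ht'.comp (Tuple.sort t).injective)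
  · rintro ⟨T, σ⟩ hT
    have hT' : StrictMono T := by simpa using hT
    have h1 : (T ∘ σ) ∘ Tuple.sort (T ∘ σ) = T := by
      rw [Tuple.comp_perm_comp_sort_eq_comp_sort,
        Tuple.sort_eq_refl_iff_monotone.2 hT'.monotone]
      rfl
    refine Prod.ext h1 ?_
    have h2 : σ * Tuple.sort (T ∘ σ) = 1 :=
      Equiv.ext fun i => hT'.injective (congrFun h1 i)
    exact (eq_inv_of_mul_eq_one_left h2).symm
  · intro t _
    funext i
    simp
  · intro _ _
    rfl

end Multiadditive

namespace UltraCochain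

open TupleCochain Nerve Topology

variable {Y : Type u} [TopologicalSpace Y] {n : ℕ}

/-- The sets whose closure does not contain `p`. -/
abbrev SetAway (p : Y) : Type u := {E : Set Y // p ∉ closure E}

/-- The Kolmogoroff chains of the complement of `p`. -/
structure IsChain {p : Y} {G : Type v} [AddCommGroup G] (f : (Fin (n + 1) → SetAway p) → G) :
    Prop where
  additive : ∀ (E : Fin (n + 1) → SetAway p) (i : Fin (n + 1)) (A B C : SetAway p),
    Disjoint A.1 B.1 → C.1 = A.1 ∪ B.1 →
      f (Function.update E i C) = f (Function.update E i A) + f (Function.update E i B)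
  perm : ∀ (E : Fin (n + 1) → SetAway p) (σ : Equiv.Perm (Fin (n + 1))),
    f (E ∘ σ) = (Equiv.Perm.sign σ : ℤ) • f E
  eq_zero_of_eq : ∀ (E : Fin (n + 1) → SetAway p) (i j : Fin (n + 1)),
    i ≠ j → E i = E j → f E = 0
  eq_zero_of_closures : ∀ E : Fin (n + 1) → SetAway p,
    (¬ ∃ y, ∀ i, y ∈ closure (E i).1) → f E = 0

variable {p : Y} {G : Type v} [AddCommGroup G] {f : (Fin (n + 1) → SetAway p) → G}

/-- The union of a finite set of fibres whose closures do not contain `p`. -/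
def fibreUnion {L : Type*} (ρ : Y → L) (A : Finset {l // p ∉ fibreClosure ρ l}) : SetAway p :=
  ⟨⋃ l ∈ A, ρ ⁻¹' {l.1}, by
    rw [Finset.closure_biUnion]
    simpa using fun l hl _ => hl⟩

/-- The fibre over a label, as a set away from `p`. -/
def fibre {L : Type*} (ρ : Y → L) (l : {l // p ∉ fibreClosure ρ l}) : SetAway p :=
  ⟨ρ ⁻¹' {l.1}, l.2⟩

theorem fibreUnion_singleton {L : Type*} (ρ : Y → L) (l : {l // p ∉ fibreClosure ρ l}) :
    fibreUnion ρ {l} = fibre ρ l := Subtype.ext (by simp [fibreUnion, fibre])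

open Classical in
/-- The value of a chain on sets that are unions of fibres of `ρ` in terms of its values on the
fibres. -/
theorem IsChain.eq_sum_det (hf : IsChain f) {L : Type*} [Finite L] (ρ : Y → L)
    [Fintype {l // p ∉ fibreClosure ρ l}] [LinearOrder {l // p ∉ fibreClosure ρ l}]
    (E : Fin (n + 1) → SetAway p) (D : Fin (n + 1) → Set L) (hE : ∀ i, (E i).1 = ρ ⁻¹' D i) :
    f E = ∑ T : Fin (n + 1) → {l // p ∉ fibreClosure ρ l} with StrictMono T,
      (Matrix.of fun i j => if (T j).1 ∈ D i then (1 : ℤ) else 0).det •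
        f fun i => fibre ρ (T i) := by
  let J : Fin (n + 1) → Finset {l // p ∉ fibreClosure ρ l} := fun i =>
    Finset.univ.filter fun l => l.1 ∈ D i
  have hEJ : E = fun i => fibreUnion ρ (J i) := by
    funext i
    refine Subtype.ext (Set.ext fun y => ?_)
    rw [hE]
    simp only [fibreUnion, J, Finset.mem_filter, Finset.mem_univ, true_and, Set.mem_iUnion,
      Set.mem_preimage, Set.mem_singleton_iff]
    constructor
    · intro hy
      -- The whole fibre through a point of `E i` lies in `E i`, so only labels with fibre closure
      -- away from `p` occur.
      refine ⟨⟨ρ y, fun hp => (E i).2 (closure_mono ?_ hp)⟩, hy, rfl⟩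
      rw [hE]
      intro z hz
      have hz' : ρ z = ρ y := hz
      rwa [Set.mem_preimage, hz']
    · rintro ⟨l, hl, hy⟩
      rwa [hy]
  have hP := eq_sum_singletons_of_additive (P := fun J : Fin (n + 1) → Finset _ =>
    f fun i => fibreUnion ρ (J i)) (fun J i A B hAB => by
      have hupd : ∀ A, (fun j => fibreUnion ρ (Function.update J i A j)) =
          Function.update (fun j => fibreUnion ρ (J j)) i (fibreUnion ρ A) := by
        intro A
        funext j
        by_cases h : j = i
        · subst h; simp
        · simp [Function.update_of_ne h]
      simp only [hupd]
      refine hf.additive _ i _ _ _ ?_ ?_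
      · rw [Set.disjoint_left]
        intro y hy hy'
        simp only [fibreUnion, Set.mem_iUnion] at hy hy'
        obtain ⟨l, hl, hly⟩ := hy
        obtain ⟨l', hl', hly'⟩ := hy'
        have : l = l' := Subtype.ext (hly.symm.trans hly')
        exact Finset.disjoint_left.1 hAB hl (this ▸ hl')
      · simp only [fibreUnion]
        rw [Finset.set_biUnion_union]) J
  simp only [fibreUnion_singleton] at hP
  rw [hEJ, hP, sum_eq_sum_strictMono_sum_perm]
  · refine Finset.sum_congr rfl fun T _ => ?_
    -- In the Leibniz formula the product attached to σ is 1 if `T (σ i)` has its label in `D i` for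
    -- all `i` and 0 otherwise, which matches the sum over rearrangements of `T`.
    rw [← Matrix.det_transpose, Matrix.det_apply, Finset.sum_smul]
    refine Finset.sum_congr rfl fun σ _ => ?_
    have hσ : (fun i => fibre ρ ((T ∘ σ) i)) = (fun i => fibre ρ (T i)) ∘ σ := rfl
    rw [hσ, hf.perm]
    simp only [Matrix.transpose_apply, Matrix.of_apply, Finset.prod_ite_zero, Finset.mem_univ,
      true_implies, Function.comp_apply, J, Finset.mem_filter, true_and, Finset.prod_const_one]
    split_ifs
    · rw [Units.smul_def, smul_eq_mul, mul_one]
    · simp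
  · intro t ht
    simp only [Function.Injective, not_forall] at ht
    obtain ⟨i, j, hij, hne⟩ := ht
    rw [hf.eq_zero_of_eq (fun i => fibre ρ (t i)) i j hne (by simp only [hij]), ite_self]

theorem detFun_apply_label {L : Type*} {ρ : Y → L} {E : Fin (n + 1) → Set Y}
    {D : Fin (n + 1) → Set L} (hE : ∀ i, E i = ρ ⁻¹' D i) {s : Point Y n} {t : Fin (n + 1) → L}
    (ht : ∀ i, ρ ⁻¹' {t i} ∈ s.1 i) [∀ i j, Decidable (t j ∈ D i)] :
    detFun E s = (Matrix.of fun i j => if t j ∈ D i then (1 : ℤ) else 0).det := by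
  rw [detFun]
  congr 1
  ext i j
  simp only [incidence, Matrix.of_apply]
  have : E i ∈ s.1 j ↔ t j ∈ D i := by
    rw [hE]
    refine ⟨fun h => ?_, fun h => Filter.mem_of_superset (ht j) fun y hy => ?_⟩
    · obtain ⟨y, hy, hyD⟩ := (s.1 j).nonempty_of_mem (Filter.inter_mem (ht j) h)
      have hy' : ρ y = t j := hy
      exact hy' ▸ hyD
    · have hy' : ρ y = t j := hy
      rwa [Set.mem_preimage, hy']
  simp only [this]

/-- A relation between the functions `detFun` is also satisfied by the values of a chain. -/
theorem IsChain.sum_eq_zero (hf : IsChain f) (x : (Fin (n + 1) → SetAway p) →₀ ℤ)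
    (hx : (x.sum fun E z => z • detFun fun i => (E i).1) = 0) : (x.sum fun E z => z • f E) = 0 := by
  classical
  -- A single finite labelling by membership patterns, of which all the sets occurring in `x` are
  -- unions of fibres.
  obtain ⟨L, _, ρ, D, hD⟩ : ∃ (L : Type u) (_ : Finite L) (ρ : Y → L)
      (D : x.support → Fin (n + 1) → Set L), ∀ E i, (E.1 i).1 = ρ ⁻¹' D E i :=
    ⟨(x.support × Fin (n + 1)) → Prop, inferInstance, fun y q => y ∈ (q.1.1 q.2).1,
      fun E i => {l | l (E, i)}, fun _ _ => rfl⟩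
  have := Fintype.ofFinite {l // p ∉ fibreClosure ρ l}
  let _ : LinearOrder {l // p ∉ fibreClosure ρ l} := IsWellOrder.linearOrder WellOrderingRel
  rw [Finsupp.sum, ← Finset.sum_coe_sort]
  have h1 : ∀ E : x.support, x E.1 • f E.1 =
      ∑ T : Fin (n + 1) → {l // p ∉ fibreClosure ρ l} with StrictMono T,
        (x E.1 * (Matrix.of fun i j => if (T j).1 ∈ D E i then (1 : ℤ) else 0).det) •
          f fun i => fibre ρ (T i) := by
    intro E
    rw [hf.eq_sum_det ρ E.1 (D E) (hD E), Finset.smul_sum]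
    refine Finset.sum_congr rfl fun T _ => ?_
    rw [mul_smul]
  rw [Finset.sum_congr rfl fun E _ => h1 E, Finset.sum_comm]
  refine Finset.sum_eq_zero fun T _ => ?_
  rw [← Finset.sum_smul]
  -- If the fibres of `T` have a common limit point, evaluating the relation at ultrafilters through
  -- these fibres shows that the coefficient is zero. If not, the chain vanishes on the fibres.
  by_cases hT : IsSimplex (fibreClosure ρ) fun i => (T i).1
  · obtain ⟨s, hs⟩ := exists_point hT
    have h2 := congrFun hx s
    rw [Finsupp.sum, ← Finset.sum_coe_sort, Finset.sum_apply] at h2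
    refine (congrArg (· • _) (Eq.trans (Finset.sum_congr rfl fun E _ => ?_) h2)).trans
      (zero_smul ℤ _)
    rw [Pi.smul_apply, smul_eq_mul, detFun_apply_label (hD E) hs]
  · rw [hf.eq_zero_of_closures (fun i => fibre ρ (T i)) hT, smul_zero]

variable (p n) in
/-- The homomorphism from the free group on tuples of sets onto the group of cochains. -/
noncomputable def ofFree : ((Fin (n + 1) → SetAway p) →₀ ℤ) →+ cochains n p :=
  (Finsupp.linearCombination ℤ fun E : Fin (n + 1) → SetAway p =>
    (⟨detFun fun i => (E i).1, detFun_mem fun i => (E i).2⟩ : cochains n p)).toAddMonoidHom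

theorem ofFree_single (E : Fin (n + 1) → SetAway p) : ofFree n p (Finsupp.single E 1) =
    ⟨detFun fun i => (E i).1, detFun_mem fun i => (E i).2⟩ := by
  simp [ofFree]

theorem ofFree_surjective : Function.Surjective (ofFree n p) := by
  rintro ⟨F, hF⟩
  induction hF using AddSubgroup.closure_induction with
  | mem F hF =>
    obtain ⟨E, hE, rfl⟩ := hF
    exact ⟨Finsupp.single (fun i => ⟨E i, hE i⟩) 1, ofFree_single _⟩
  | zero => exact ⟨0, map_zero _⟩
  | add F F' _ _ h h' =>
    obtain ⟨x, hx⟩ := h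
    obtain ⟨x', hx'⟩ := h'
    exact ⟨x + x', by rw [map_add, hx, hx']; rfl⟩
  | neg F _ h =>
    obtain ⟨x, hx⟩ := h
    exact ⟨-x, by rw [map_neg, hx]; rfl⟩

/-- A Kolmogoroff chain extends to a homomorphism on the group of cochains. -/
theorem IsChain.exists_hom (hf : IsChain f) : ∃ φ : cochains n p →+ G,
    ∀ E : Fin (n + 1) → SetAway p,
      φ ⟨detFun fun i => (E i).1, detFun_mem fun i => (E i).2⟩ = f E := by
  let g : ((Fin (n + 1) → SetAway p) →₀ ℤ) →+ G :=
    (Finsupp.linearCombination ℤ f).toAddMonoidHom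
  have hker : (ofFree n p).ker ≤ g.ker := by
    intro x hx
    refine hf.sum_eq_zero x ?_
    have h := congrArg (cochains n p).subtype (AddMonoidHom.mem_ker.1 hx)
    rw [map_zero] at h
    rw [← h, ofFree]
    simp [Finsupp.linearCombination_apply, Finsupp.sum]
  refine ⟨(ofFree n p).liftOfSurjective ofFree_surjective ⟨g, hker⟩, fun E => ?_⟩
  rw [← ofFree_single]
  refine ((ofFree n p).liftOfRightInverse_comp_apply _ _ ⟨g, hker⟩ _).trans ?_
  simp [g]

theorem hom_ext {φ ψ : cochains n p →+ G} (h : ∀ E : Fin (n + 1) → SetAway p,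
    φ ⟨detFun fun i => (E i).1, detFun_mem fun i => (E i).2⟩ =
      ψ ⟨detFun fun i => (E i).1, detFun_mem fun i => (E i).2⟩) : φ = ψ := by
  refine (AddMonoidHom.cancel_right ofFree_surjective).1 (Finsupp.addHom_ext fun E z => ?_)
  rw [← mul_one z, ← smul_eq_mul, ← Finsupp.smul_single, map_zsmul, map_zsmul]
  simp only [AddMonoidHom.comp_apply, ofFree_single, h]

/-- The restriction of a homomorphism to the generators is a chain. -/
theorem isChain_of_hom (φ : cochains n p →+ G) : IsChain fun E : Fin (n + 1) → SetAway p =>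
    φ ⟨detFun fun i => (E i).1, detFun_mem fun i => (E i).2⟩ where
  additive E i A B C hAB hC := by
    rw [← map_add]
    congr 1
    refine Subtype.ext (funext fun s => ?_)
    have hupd : ∀ A : SetAway p, incidence (fun j => (Function.update E i A j).1) s.1 =
        (incidence (fun j => (E j).1) s.1).updateRow i fun j =>
          incidence (fun _ : Fin (n + 1) => A.1) s.1 i j := by
      intro A
      ext j k
      by_cases h : j = i
      · subst h
        rw [Matrix.updateRow_self]
        exact incidence_congr (by rw [Function.update_self])
      · rw [Matrix.updateRow_ne h]
        exact incidence_congr (by rw [Function.update_of_ne h])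
    change (incidence _ s.1).det = (incidence _ s.1).det + (incidence _ s.1).det
    rw [hupd, hupd, hupd, ← Matrix.det_updateRow_add]
    congr 2
    funext j
    -- An ultrafilter containing a disjoint union contains exactly one of the parts, so row `i` for
    -- `C` is the sum of the rows for `A` and `B`.
    have hCj : C.1 ∈ s.1 j ↔ A.1 ∈ s.1 j ∨ B.1 ∈ s.1 j := by rw [hC, Ultrafilter.union_mem_iff]
    rw [Pi.add_apply]
    by_cases h1 : A.1 ∈ s.1 j
    · have h2 : B.1 ∉ s.1 j := fun h2 => by
        obtain ⟨y, hy, hy'⟩ := (s.1 j).nonempty_of_mem (Filter.inter_mem h1 h2)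
        exact Set.disjoint_left.1 hAB hy hy'
      rw [incidence_of_mem (hCj.2 (.inl h1)), incidence_of_mem h1, incidence_of_notMem h2, add_zero]
    · rw [incidence_of_notMem (E := fun _ : Fin (n + 1) => A.1) h1, zero_add]
      exact incidence_congr (by simp [hCj, h1])
  perm E σ := by
    rw [← map_zsmul]
    congr 1
    refine Subtype.ext (funext fun s => ?_)
    have h := Matrix.det_permute σ (incidence (fun j => (E j).1) s.1)
    rw [Int.cast_id] at h
    exact h
  eq_zero_of_eq E i j hij h := by
    rw [← map_zero φ]
    congr 1
    refine Subtype.ext (funext fun s => ?_)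
    exact Matrix.det_zero_of_row_eq hij (funext fun k => incidence_congr (by rw [h]))
  eq_zero_of_closures E h := by
    rw [← map_zero φ]
    congr 1
    refine Subtype.ext (funext fun s => ?_)
    obtain ⟨y, hy⟩ := s.2
    push Not at h
    obtain ⟨i, hi⟩ := h y
    exact detFun_eq_zero hy hi

end UltraCochain

/-! ## Homology classes in complexes of abelian groups -/

namespace CategoryTheory.ShortComplex

/-- The homology class of a cycle. -/
noncomputable def abClass (S : ShortComplex AddCommGrpCat.{w}) : S.g.hom.ker →+ S.homology :=
  (S.abCyclesIso.inv ≫ S.homologyπ).hom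

theorem abClass_eq (S : ShortComplex AddCommGrpCat.{w}) :
    S.abClass = S.abHomologyIso.inv.hom.comp (QuotientAddGroup.mk' _) :=
  congrArg AddCommGrpCat.Hom.hom (S.abLeftHomologyData.π_comp_homologyIso_inv).symm

theorem abClass_surjective (S : ShortComplex AddCommGrpCat.{w}) :
    Function.Surjective S.abClass := by
  rw [abClass_eq]
  exact ((AddCommGrpCat.epi_iff_surjective S.abHomologyIso.inv).1 inferInstance).comp
    (QuotientAddGroup.mk'_surjective _)

theorem abClass_eq_zero_iff (S : ShortComplex AddCommGrpCat.{w}) (x : S.g.hom.ker) :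
    S.abClass x = 0 ↔ ∃ y, S.f.hom y = x.1 := by
  have hinj := (AddCommGrpCat.mono_iff_injective S.abHomologyIso.inv).1 inferInstance
  rw [abClass_eq, AddMonoidHom.comp_apply]
  refine (map_eq_zero_iff S.abHomologyIso.inv.hom hinj).trans ?_
  rw [QuotientAddGroup.mk'_apply, QuotientAddGroup.eq_zero_iff]
  exact exists_congr fun y => Subtype.ext_iff

theorem homologyMap_abClass {S T : ShortComplex AddCommGrpCat.{w}} (φ : S ⟶ T) (x : S.g.hom.ker)
    (y : T.g.hom.ker) (h : φ.τ₂.hom x.1 = y.1) :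
    (homologyMap φ).hom (S.abClass x) = T.abClass y := by
  have h1 : (cyclesMap φ).hom (S.abCyclesIso.inv.hom x) = T.abCyclesIso.inv.hom y := by
    refine (AddCommGrpCat.mono_iff_injective T.iCycles).1 inferInstance ?_
    refine Eq.trans ?_ (T.abCyclesIso_inv_apply_iCycles y).symm
    rw [← h, ← S.abCyclesIso_inv_apply_iCycles x]
    exact ConcreteCategory.congr_hom (cyclesMap_i φ) _
  change _ = T.homologyπ.hom (T.abCyclesIso.inv.hom y)
  rw [← h1]
  exact ConcreteCategory.congr_hom (homologyπ_naturality φ) _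

end CategoryTheory.ShortComplex

namespace HomologicalComplex

variable {ι : Type*} {c : ComplexShape ι} (K L : HomologicalComplex AddCommGrpCat.{w} c)

/-- The homology class of a cycle. -/
noncomputable def abClass {i j : ι} (hj : c.next i = j) : (K.d i j).hom.ker →+ K.homology i :=
  (K.sc i).abClass.comp (AddSubgroup.inclusion (by subst hj; exact le_rfl))

theorem abClass_surjective {i j : ι} (hj : c.next i = j) :
    Function.Surjective (K.abClass hj) := by
  subst hj
  exact (K.sc i).abClass_surjective

theorem abClass_eq_zero_iff {i j k : ι} (hj : c.next i = j) (hk : c.prev i = k)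
    (x : (K.d i j).hom.ker) : K.abClass hj x = 0 ↔ ∃ y, (K.d k i).hom y = x.1 := by
  subst hj hk
  exact (K.sc i).abClass_eq_zero_iff x

variable {K L}

theorem homologyMap_abClass (φ : K ⟶ L) {i j : ι} (hj : c.next i = j) (x : (K.d i j).hom.ker)
    (y : (L.d i j).hom.ker) (h : (φ.f i).hom x.1 = y.1) :
    (homologyMap φ i).hom (K.abClass hj x) = L.abClass hj y := by
  subst hj
  exact ShortComplex.homologyMap_abClass ((shortComplexFunctor _ _ i).map φ) x y h

end HomologicalComplex

/-! ## The universal coefficient theorem -/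

section Ext

variable {A Z H : Type u} [AddCommGroup A] [AddCommGroup Z] [AddCommGroup H]
  {G : Type v} [AddCommGroup G]

open Abelian in
/-- A presentation of `H` with free generators computes `Ext¹(H, G)`. -/
theorem exists_hom_extAb [Module.Free ℤ Z] (ι : A →+ Z) (θ : Z →+ H)
    (hι : Function.Injective ι) (hθ : Function.Surjective θ) (hex : Function.Exact ι θ) :
    ∃ δ : (A →+ G) →+ ExtAb H G, Function.Surjective δ ∧
      ∀ g, δ g = 0 ↔ ∃ h : Z →+ G, h.comp ι = g := by
  let lift {B C : Type u} [AddCommGroup B] [AddCommGroup C] (f : B →+ C) :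
      ModuleCat.of ℤ (ULift.{v} B) ⟶ ModuleCat.of ℤ (ULift.{v} C) :=
    ModuleCat.ofHom ((AddEquiv.ulift.symm.toAddMonoidHom.comp
      (f.comp AddEquiv.ulift.toAddMonoidHom)).toIntLinearMap)
  let liftG {B : Type u} [AddCommGroup B] : (B →+ G) →+
      (ModuleCat.of ℤ (ULift.{v} B) ⟶ ModuleCat.of ℤ (ULift.{u} G)) :=
    { toFun := fun f => ModuleCat.ofHom ((AddEquiv.ulift.symm.toAddMonoidHom.comp
        (f.comp AddEquiv.ulift.toAddMonoidHom)).toIntLinearMap)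
      map_zero' := rfl
      map_add' := fun _ _ => rfl }
  have hliftG : ∀ {B : Type u} [AddCommGroup B], Function.Bijective (liftG (B := B)) := by
    intro B _
    refine ⟨fun f g h => AddMonoidHom.ext fun b => ?_, fun φ => ?_⟩
    · exact congrArg ULift.down (ConcreteCategory.congr_hom h ⟨b⟩)
    · refine ⟨AddEquiv.ulift.toAddMonoidHom.comp
        (φ.hom.toAddMonoidHom.comp AddEquiv.ulift.symm.toAddMonoidHom), ?_⟩
      ext x
      rfl
  let S : ShortComplex (ModuleCat.{max u v} ℤ) := ShortComplex.mk (lift ι) (lift θ) (by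
    ext x
    exact hex.apply_apply_eq_zero x.down)
  have hS : S.ShortExact :=
    { exact := by
        rw [ShortComplex.ShortExact.moduleCat_exact_iff_function_exact]
        intro x
        refine ⟨fun hx => ?_, ?_⟩
        · obtain ⟨a, ha⟩ := (hex x.down).1 (congrArg ULift.down hx)
          exact ⟨⟨a⟩, congrArg ULift.up ha⟩
        · rintro ⟨a, rfl⟩
          exact congrArg ULift.up (hex.apply_apply_eq_zero a.down)
      mono_f := by
        rw [ModuleCat.mono_iff_injective]
        exact fun x y h => ULift.ext _ _ (hι (congrArg ULift.down h))
      epi_g := by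
        rw [ModuleCat.epi_iff_surjective]
        intro x
        obtain ⟨z, hz⟩ := hθ x.down
        exact ⟨⟨z⟩, congrArg ULift.up hz⟩ }
  have : Module.Free ℤ (ULift.{v} Z) :=
    Module.Free.of_equiv (AddEquiv.ulift (α := Z)).symm.toIntLinearEquiv
  have : Projective S.X₂ := ModuleCat.projective_of_free (Module.Free.chooseBasis ℤ (ULift.{v} Z))
  let Q := ModuleCat.of ℤ (ULift.{u} G)
  -- The connecting map: Yoneda product with the class of the extension. It is onto because Ext¹ of
  -- the projective middle term vanishes.
  let δ : (A →+ G) →+ Ext S.X₃ Q 1 :=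
    ((hS.extClass.precomp Q (add_zero 1)).comp Ext.addEquiv₀.symm.toAddMonoidHom).comp liftG
  have hδ : ∀ g, δ g = hS.extClass.comp (Ext.mk₀ (liftG g)) (add_zero 1) := fun g => rfl
  refine ⟨δ, fun x => ?_, fun g => ⟨fun h => ?_, ?_⟩⟩
  · obtain ⟨x₁, hx₁⟩ := Ext.contravariant_sequence_exact₃ hS Q x (Ext.eq_zero_of_projective _)
      (add_zero 1)
    obtain ⟨φ, rfl⟩ := (Ext.mk₀_bijective _ _).2 x₁
    obtain ⟨g, rfl⟩ := hliftG.2 φ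
    exact ⟨g, hx₁⟩
  · obtain ⟨x₂, hx₂⟩ := Ext.contravariant_sequence_exact₁ hS Q _ (add_zero 1) h
    obtain ⟨φ, rfl⟩ := (Ext.mk₀_bijective _ _).2 x₂
    obtain ⟨h, rfl⟩ := hliftG.2 φ
    rw [Ext.mk₀_comp_mk₀] at hx₂
    exact ⟨h, hliftG.1 ((Ext.mk₀_bijective _ _).1 hx₂)⟩
  · rintro ⟨h, rfl⟩
    have : liftG (h.comp ι) = S.f ≫ liftG h := rfl
    rw [hδ, this, ← Ext.mk₀_comp_mk₀]
    exact hS.extClass_comp_assoc _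

end Ext

section UniversalCoefficients

/-- The image of `d` is a subgroup of a free group, hence free, so `M` splits as kernel plus image.
-/
theorem AddMonoidHom.exists_retraction {M N : Type*} [AddCommGroup M] [AddCommGroup N]
    [Module.Free ℤ N] (d : M →+ N) : ∃ r : M →+ d.ker, ∀ x : d.ker, r x.1 = x := by
  have := Submodule.free_of_free (LinearMap.range d.toIntLinearMap)
  obtain ⟨s, hs⟩ := Module.projective_lifting_property d.toIntLinearMap.rangeRestrict
    LinearMap.id d.toIntLinearMap.surjective_rangeRestrict
  have hs' : ∀ y, d (s y) = y.1 := fun y => congrArg Subtype.val (LinearMap.congr_fun hs y)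
  let r : M →+ M := AddMonoidHom.id M - s.toAddMonoidHom.comp
    d.toIntLinearMap.rangeRestrict.toAddMonoidHom
  have hr : ∀ x, d (r x) = 0 := by
    intro x
    change d (x - s (d.toIntLinearMap.rangeRestrict x)) = 0
    rw [map_sub, hs']
    exact sub_self (d x)
  refine ⟨r.codRestrict d.ker hr, fun x => Subtype.ext ?_⟩
  change x.1 - s (d.toIntLinearMap.rangeRestrict x.1) = x.1
  have : d.toIntLinearMap.rangeRestrict x.1 = 0 := Subtype.ext x.2
  rw [this, map_zero, sub_zero]

variable {M N P H H' : Type u} [AddCommGroup M] [AddCommGroup N] [AddCommGroup P]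
  [AddCommGroup H] [AddCommGroup H'] {G : Type v} [AddCommGroup G] {Q : Type w} [AddCommGroup Q]

/-- The homomorphisms that vanish on a subgroup. -/
def AddSubgroup.annihilatorHom (B : AddSubgroup M) (G : Type v) [AddCommGroup G] :
    AddSubgroup (M →+ G) where
  carrier := {f | ∀ b ∈ B, f b = 0}
  zero_mem' _ _ := rfl
  add_mem' hf hg b hb := by simp [hf b hb, hg b hb]
  neg_mem' hf b hb := by simp [hf b hb]

/-- The universal coefficient theorem: `H` and `H'` are consecutive cohomology groups of a complex
of free groups, and `Q` is the homology group of the dual complex. -/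
theorem exists_universalCoefficients [Module.Free ℤ N] [Module.Free ℤ P]
    (d : M →+ N) (d' : N →+ P) (B : AddSubgroup M) (hB : B ≤ d.ker) (hdd : ∀ x, d' (d x) = 0)
    (θ : d.ker →+ H) (hθ : Function.Surjective θ) (hθB : ∀ x, θ x = 0 ↔ x.1 ∈ B)
    (θ' : d'.ker →+ H') (hθ' : Function.Surjective θ')
    (hθd : ∀ x, θ' x = 0 ↔ ∃ y, d y = x.1)
    (q : B.annihilatorHom G →+ Q) (hq : Function.Surjective q)
    (hq0 : ∀ f, q f = 0 ↔ ∃ F : N →+ G, F.comp d = f.1) :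
    ∃ (i : ExtAb H' G →+ Q) (p : Q →+ (H →+ G)),
      Function.Injective i ∧ Function.Exact i p ∧ Function.Surjective p := by
  have : Module.Free ℤ d'.ker := Submodule.free_of_free (LinearMap.ker d'.toIntLinearMap)
  have hle : d.range ≤ d'.ker := by rintro _ ⟨x, rfl⟩; exact hdd x
  obtain ⟨δ, hδ, hδ0⟩ := exists_hom_extAb (G := G) (AddSubgroup.inclusion hle) θ'
    (AddSubgroup.inclusion_injective hle) hθ' (fun x => by
      rw [hθd]
      exact ⟨fun ⟨y, hy⟩ => ⟨⟨d y, y, rfl⟩, Subtype.ext hy⟩, fun ⟨⟨_, y, rfl⟩, h⟩ =>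
        ⟨y, congrArg Subtype.val h⟩⟩)
  obtain ⟨ρ, hρ⟩ := d.exists_retraction
  obtain ⟨ρ', hρ'⟩ := d'.exists_retraction
  let j : (d.range →+ G) →+ Q := q.comp
    { toFun := fun g => ⟨g.comp d.rangeRestrict, fun b hb => by
        have : d.rangeRestrict b = 0 := Subtype.ext (hB hb)
        rw [AddMonoidHom.comp_apply, this, map_zero]⟩
      map_zero' := rfl
      map_add' := fun _ _ => rfl }
  -- A homomorphism on the range of `d` extends to `N` if and only if it extends to the kernel of
  -- `d'`, by the retraction `ρ'`. Equality of the two kernels makes the induced map `i` on Ext both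
  -- well defined and injective.
  have hj0 : ∀ g, j g = 0 ↔ δ g = 0 := by
    intro g
    rw [hδ0]
    refine (hq0 _).trans ⟨?_, ?_⟩
    · rintro ⟨F, hF⟩
      refine ⟨F.comp d'.ker.subtype, AddMonoidHom.ext ?_⟩
      rintro ⟨_, x, rfl⟩
      exact DFunLike.congr_fun hF x
    · rintro ⟨h, rfl⟩
      refine ⟨h.comp ρ', AddMonoidHom.ext fun x => ?_⟩
      exact congrArg h (hρ' ⟨d x, hdd x⟩)
  let r₀ : B.annihilatorHom G → (H →+ G) := fun f =>
    θ.liftOfSurjective hθ ⟨f.1.comp d.ker.subtype, fun x hx => f.2 _ ((hθB x).1 hx)⟩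
  have hr : ∀ f x, r₀ f (θ x) = f.1 x.1 := fun f x =>
    θ.liftOfRightInverse_comp_apply _ _ _ _
  let r : B.annihilatorHom G →+ (H →+ G) := AddMonoidHom.mk' r₀ fun f g =>
    AddMonoidHom.ext fun y => by
      obtain ⟨x, rfl⟩ := hθ y
      rw [AddMonoidHom.add_apply, hr, hr, hr]
      rfl
  replace hr : ∀ f x, r f (θ x) = f.1 x.1 := hr
  have hr0 : ∀ f, q f = 0 → r f = 0 := by
    intro f hf
    obtain ⟨F, hF⟩ := (hq0 f).1 hf
    refine AddMonoidHom.ext fun y => ?_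
    obtain ⟨x, rfl⟩ := hθ y
    rw [hr, ← hF, AddMonoidHom.comp_apply, x.2, map_zero]
    rfl
  let i : ExtAb H' G →+ Q := δ.liftOfSurjective hδ ⟨j, fun g hg => (hj0 g).2 hg⟩
  have hi : ∀ g, i (δ g) = j g := fun g => δ.liftOfRightInverse_comp_apply _ _ _ _
  let p : Q →+ (H →+ G) := q.liftOfSurjective hq ⟨r, hr0⟩
  have hp : ∀ f, p (q f) = r f := fun f => q.liftOfRightInverse_comp_apply _ _ _ _
  refine ⟨i, p, (injective_iff_map_eq_zero i).2 fun x hx => ?_, fun y => ⟨fun hy => ?_, ?_⟩,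
    fun h => ?_⟩
  · obtain ⟨g, rfl⟩ := hδ x
    rw [hi] at hx
    exact (hj0 g).1 hx
  · obtain ⟨f, rfl⟩ := hq y
    rw [hp] at hy
    have hf : d.ker ≤ f.1.ker := fun x hx => by
      rw [AddMonoidHom.mem_ker, ← hr f ⟨x, hx⟩, hy]
      rfl
    have hsurj : Function.Surjective d.rangeRestrict := d.rangeRestrict_surjective
    let g : d.range →+ G := d.rangeRestrict.liftOfSurjective hsurj
      ⟨f.1, by rwa [AddMonoidHom.ker_rangeRestrict]⟩
    refine ⟨δ g, (hi g).trans (congrArg q (Subtype.ext (AddMonoidHom.ext fun x => ?_)))⟩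
    exact d.rangeRestrict.liftOfRightInverse_comp_apply _ (Function.rightInverse_surjInv hsurj) _ _
  · rintro ⟨x, rfl⟩
    obtain ⟨g, rfl⟩ := hδ x
    rw [hi]
    change p (q _) = 0
    rw [hp]
    refine AddMonoidHom.ext fun y => ?_
    obtain ⟨x, rfl⟩ := hθ y
    rw [hr]
    have : d.rangeRestrict x.1 = 0 := Subtype.ext x.2
    change g (d.rangeRestrict x.1) = 0
    rw [this, map_zero]
  -- The retraction `ρ` extends `h ∘ θ` from the cocycles to all of `M`.
  · refine ⟨q ⟨(h.comp θ).comp ρ, fun b hb => ?_⟩, ?_⟩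
    · have h1 : ρ b = ⟨b, hB hb⟩ := hρ ⟨b, hB hb⟩
      rw [AddMonoidHom.comp_apply, AddMonoidHom.comp_apply, h1, (hθB _).2 hb, map_zero]
    · rw [hp]
      refine AddMonoidHom.ext fun y => ?_
      obtain ⟨x, rfl⟩ := hθ y
      rw [hr]
      exact congrArg (h.comp θ) (hρ x)

end UniversalCoefficients

/-! ## Comparison with Čech cohomology -/

/-- For a set `J` of indices with empty intersection of the `Z l`, the complements cover `Y`;
shrinking this open cover to a closed one and passing to complements enlarges the `Z l` to open sets
whose intersection over `J` is still empty. -/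
theorem exists_swelling {Y L : Type*} [TopologicalSpace Y] [NormalSpace Y] [T1Space Y] [Finite L]
    (p : Y) {Z W : L → Set Y} (hZ : ∀ l, IsClosed (Z l)) (hW : ∀ l, IsOpen (W l))
    (hZW : ∀ l, Z l ⊆ W l) :
    ∃ O : L → Set Y, (∀ l, IsOpen (O l)) ∧ (∀ l, Z l ⊆ O l) ∧ (∀ l, O l ⊆ W l) ∧
      (∀ l, p ∈ O l → p ∈ Z l) ∧
      ∀ {n : ℕ} (t : Fin (n + 1) → L), Nerve.IsSimplex O t → Nerve.IsSimplex Z t := by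
  classical
  have key : ∀ J : Set L, ∃ O : L → Set Y, (∀ l, IsOpen (O l)) ∧ (∀ l, Z l ⊆ O l) ∧
      (⋂ l ∈ J, Z l = ∅ → ⋂ l ∈ J, O l = ∅) := by
    intro J
    by_cases hJ : ⋂ l ∈ J, Z l = ∅
    · obtain ⟨v, hv, hvc, hvs⟩ := exists_iUnion_eq_closed_subset (u := fun l : J => (Z l)ᶜ)
        (fun l => (hZ l).isOpen_compl) (fun _ => Set.toFinite _) (by
          rw [← Set.compl_iInter, ← Set.biInter_eq_iInter J fun l _ => Z l, hJ, Set.compl_empty])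
      refine ⟨fun l => if h : l ∈ J then (v ⟨l, h⟩)ᶜ else Set.univ, fun l => ?_, fun l => ?_,
        fun _ => ?_⟩
      · by_cases h : l ∈ J
        · simpa [h] using (hvc ⟨l, h⟩)
        · simp [h]
      · by_cases h : l ∈ J
        · simpa [h] using Set.subset_compl_comm.1 (hvs ⟨l, h⟩)
        · simp [h]
      · refine Set.eq_empty_of_forall_notMem fun y hy => ?_
        obtain ⟨l, hl⟩ := Set.mem_iUnion.1 (hv ▸ Set.mem_univ y)
        have := Set.mem_iInter₂.1 hy l.1 l.2
        simp only [l.2, dite_true] at this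
        exact this hl
    · exact ⟨fun _ => Set.univ, fun _ => isOpen_univ, fun _ => Set.subset_univ _,
        fun h => absurd h hJ⟩
  choose O hO hZO hOJ using key
  -- There are finitely many `J`, so the intersection over them stays open. Deleting `p` where `p ∉
  -- Z l` keeps the trace on `{p}`, so relative cochains stay relative.
  refine ⟨fun l => (W l ∩ ⋂ J, O J l) ∩ if p ∈ Z l then Set.univ else {p}ᶜ, fun l => ?_,
    fun l => ?_, fun l y hy => hy.1.1, fun l hp => ?_, fun {n} t ht => ?_⟩
  · refine ((hW l).inter (isOpen_iInter_of_finite fun J => hO J l)).inter ?_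
    split_ifs
    · exact isOpen_univ
    · exact isClosed_singleton.isOpen_compl
  · refine Set.subset_inter (Set.subset_inter (hZW l) (Set.subset_iInter fun J => hZO J l)) ?_
    split_ifs with h
    · exact Set.subset_univ _
    · exact Set.subset_compl_singleton_iff.2 h
  · by_contra h
    have := hp.2
    rw [if_neg h] at this
    exact this rfl
  · obtain ⟨y, hy⟩ := ht
    have hne : ⋂ l ∈ Set.range t, Z l ≠ ∅ := fun h => by
      have : y ∈ ⋂ l ∈ Set.range t, O (Set.range t) l := by
        simp only [Set.mem_range, Set.iInter_exists, Set.iInter_iInter_eq', Set.mem_iInter]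
        exact fun i => Set.mem_iInter.1 (hy i).1.2 _
      rw [hOJ _ h] at this
      exact this
    obtain ⟨z, hz⟩ := Set.nonempty_iff_ne_empty.2 hne
    exact ⟨z, fun i => Set.mem_iInter₂.1 hz (t i) ⟨i, rfl⟩⟩

/-! ### Open covers, subordinate partitions and extension of cochains by zero -/

namespace Cech

open TupleCochain Nerve

variable {Y : Type u} [TopologicalSpace Y] {n : ℕ}

/-- The cover by the members of an indexed family. -/
def OpenCover.ofFamily {L : Type*} (O : L → Set Y) (hO : ∀ l, IsOpen (O l))
    (hc : ∀ y, ∃ l, y ∈ O l) : OpenCover Y where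
  sets := Set.range O
  isOpen := by rintro _ ⟨l, rfl⟩; exact hO l
  covers := Set.eq_univ_of_forall fun y => by
    obtain ⟨l, hl⟩ := hc y
    exact ⟨O l, ⟨l, rfl⟩, hl⟩

instance : Nonempty (OpenCover Y) :=
  ⟨{ sets := {Set.univ}, isOpen := by simp, covers := by simp }⟩

instance : IsDirectedOrder (OpenCover Y) where
  directed α β := by
    refine ⟨{ sets := {W | ∃ U ∈ α.sets, ∃ V ∈ β.sets, W = U ∩ V}, isOpen := ?_, covers := ?_ },
      ?_, ?_⟩
    · rintro _ ⟨U, hU, V, hV, rfl⟩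
      exact (α.isOpen U hU).inter (β.isOpen V hV)
    · refine Set.eq_univ_of_forall fun y => ?_
      obtain ⟨U, hU, hy⟩ := Set.mem_sUnion.1 (α.covers ▸ Set.mem_univ y)
      obtain ⟨V, hV, hy'⟩ := Set.mem_sUnion.1 (β.covers ▸ Set.mem_univ y)
      exact ⟨U ∩ V, ⟨U, hU, V, hV, rfl⟩, hy, hy'⟩
    · rintro _ ⟨U, hU, V, hV, rfl⟩
      exact ⟨U, hU, Set.inter_subset_left⟩
    · rintro _ ⟨U, hU, V, hV, rfl⟩
      exact ⟨V, hV, Set.inter_subset_right⟩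

/-- The finite partitions of a compact Hausdorff space subordinate to an open cover. -/
theorem OpenCover.exists_partition [CompactSpace Y] [T2Space Y] (α : OpenCover Y) :
    ∃ π : Y → α.sets, (Set.range π).Finite ∧ ∀ U, closure (π ⁻¹' {U}) ⊆ U.1 := by
  classical
  obtain ⟨t, ht⟩ := isCompact_univ.elim_finite_subcover (fun U : α.sets => U.1)
    (fun U => α.isOpen U.1 U.2) (by rw [← Set.sUnion_eq_iUnion, α.covers])
  -- Shrinking a finite subcover to closed sets and sending each point to one of those containing it
  -- keeps the fibre closures inside the members.
  obtain ⟨v, hv, hvc, hvs⟩ := exists_iUnion_eq_closed_subset (u := fun U : t => U.1.1)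
    (fun U => α.isOpen U.1.1 U.1.2) (fun _ => Set.toFinite _) (by
      rw [← Set.univ_subset_iff]
      refine ht.trans fun y hy => ?_
      obtain ⟨U, hU, hy⟩ := Set.mem_iUnion₂.1 hy
      exact Set.mem_iUnion.2 ⟨⟨U, hU⟩, hy⟩)
  choose π hπ using fun y => Set.mem_iUnion.1 (hv.symm ▸ Set.mem_univ y : y ∈ ⋃ i, v i)
  refine ⟨fun y => (π y).1, ?_, fun U => ?_⟩
  · refine t.finite_toSet.subset ?_
    rintro _ ⟨y, rfl⟩
    exact (π y).2
  · by_cases hU : U ∈ t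
    · refine (closure_minimal ?_ (hvc ⟨U, hU⟩)).trans (hvs ⟨U, hU⟩)
      intro y hy
      have : π y = ⟨U, hU⟩ := Subtype.ext hy
      exact this ▸ hπ y
    · have : (fun y => (π y).1) ⁻¹' {U} = ∅ := Set.eq_empty_of_forall_notMem fun y hy => by
        have hy' : (π y).1 = U := hy
        exact hU (hy' ▸ (π y).2)
      rw [this, closure_empty]
      exact Set.empty_subset _

theorem isSimplex_iff {α : OpenCover Y} {s : Fin (n + 1) → α.sets} :
    IsSimplex (fun U : α.sets => U.1) s ↔ (inter s).Nonempty := by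
  simp [IsSimplex, inter, Set.Nonempty]

variable {p : Y} {α β : OpenCover Y}

open Classical in
/-- The extension of a relative cochain by zero to all tuples. -/
noncomputable def extend : cochains {p} α n →+ Cochain α.sets n where
  toFun c s := if h : (inter s).Nonempty then c.1 ⟨s, h⟩ else 0
  map_zero' := funext fun s => by simp
  map_add' c d := funext fun s => by
    by_cases h : (inter s).Nonempty <;> simp [h]

theorem extend_apply (c : cochains {p} α n) (s : Simplex α n) : extend c s.1 = c.1 s :=
  dif_pos s.2

theorem δ_extend_apply (c : cochains {p} α n) (s : Simplex α (n + 1)) :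
    δ (extend c) s.1 = (coboundary {p} α n c).1 s := by
  rw [δ_apply]
  exact Finset.sum_congr rfl fun i _ => congrArg _ (extend_apply c (s.face i))

theorem isRel_extend (c : cochains {p} α n) : IsRel p (fun U : α.sets => U.1) (extend c) := by
  intro s hs
  have hs' : p ∈ inter s := Set.mem_iInter.2 hs
  rw [extend_apply c ⟨s, p, hs'⟩]
  exact c.2 _ ⟨p, hs', rfl⟩

theorem isCocycle_extend {c : cochains {p} α n} (hc : coboundary {p} α n c = 0) :
    IsCocycle (fun U : α.sets => U.1) (extend c) := by
  intro s hs
  rw [δ_extend_apply c ⟨s, isSimplex_iff.1 hs⟩, hc]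
  rfl

/-- The restriction of a relative cochain to the simplices of the nerve. -/
def restrict (a : Cochain α.sets n) (ha : IsRel p (fun U : α.sets => U.1) a) :
    cochains {p} α n :=
  ⟨fun s => a s.1, fun s ⟨y, hy, hyp⟩ => ha s.1 fun i => by
    have : y = p := hyp
    exact this ▸ Set.mem_iInter.1 hy i⟩

theorem extend_restrict_apply {a : Cochain α.sets n} (ha : IsRel p (fun U : α.sets => U.1) a)
    {s : Fin (n + 1) → α.sets} (hs : IsSimplex (fun U : α.sets => U.1) s) :
    extend (restrict a ha) s = a s :=
  extend_apply (restrict a ha) ⟨s, isSimplex_iff.1 hs⟩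

theorem extend_pullback_apply (q : Projection α β) (c : cochains {p} α n)
    {s : Fin (n + 1) → β.sets} (hs : IsSimplex (fun U : β.sets => U.1) s) :
    extend (q.pullback {p} n c) s = pull q.toFun (extend c) s := by
  rw [extend_apply _ ⟨s, isSimplex_iff.1 hs⟩]
  exact (extend_apply c ⟨q.toFun ∘ s, _⟩).symm

end Cech

/-! ### Exactness of cochains on ultrafilters, read off from labellings -/

namespace UltraCochain

open TupleCochain Nerve Topology

variable {Y : Type u} [TopologicalSpace Y] {n : ℕ} {p : Y}

theorem exists_isPull_of_cochain {L : Type*} {ρ : Y → L} (hρ : (Set.range ρ).Finite)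
    (a : Cochain L n) : ∃ F : Point Y n → ℤ, IsPull ρ a F := by
  choose t ht using fun s : Point Y n => exists_label hρ s
  refine ⟨fun s => a (t s), fun s t' ht' => congrArg a (funext fun i => ?_)⟩
  exact Ultrafilter.eq_of_preimage_singleton_mem (ht s i) (ht' i)

/-- The label tuples of points are simplices of the nerve of the fibre closures; conversely each
such simplex labels a point, which gives `IsPull.apply_eq`. -/
theorem IsPull.eq {L : Type*} {ρ : Y → L} (hρ : (Set.range ρ).Finite) {a b : Cochain L n}
    {F F' : Point Y n → ℤ} (hF : IsPull ρ a F) (hF' : IsPull ρ b F')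
    (h : ∀ t, IsSimplex (fibreClosure ρ) t → a t = b t) : F = F' := by
  funext s
  obtain ⟨t, ht⟩ := exists_label hρ s
  rw [hF s t ht, hF' s t ht, h t (isSimplex_label ht)]

theorem IsPull.apply_eq {L : Type*} {ρ : Y → L} {a b : Cochain L n} {F : Point Y n → ℤ}
    (hF : IsPull ρ a F) (hF' : IsPull ρ b F) {t : Fin (n + 1) → L}
    (ht : IsSimplex (fibreClosure ρ) t) : a t = b t := by
  obtain ⟨s, hs⟩ := exists_point ht
  rw [← hF s t hs, hF' s t hs]

variable [T2Space Y] [CompactSpace Y]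

theorem mem_of_isPull_of_finite_range {L : Type*} {ρ : Y → L} (hρ : (Set.range ρ).Finite)
    {a : Cochain L n} {F : Point Y n → ℤ} (ha : IsAlt a) (har : IsRel p (fibreClosure ρ) a)
    (hF : IsPull ρ a F) : F ∈ cochains n p := by
  have := hρ.to_subtype
  have hτ : Subtype.val ∘ Set.rangeFactorization ρ = ρ := rfl
  exact mem_of_isPull (ha.pull Subtype.val)
    (har.pull fun w hw => fibreClosure_subset Subtype.val hτ w hw) (hF.comp Subtype.val hτ)

variable (p) in
/-- `F` is the coboundary of a cochain. -/
def IsExact : ∀ {n : ℕ}, (Point Y n → ℤ) → Prop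
  | 0, F => F = 0
  | n + 1, F => ∃ B ∈ cochains n p, coboundary B = F

theorem IsPull.isExact {L : Type*} {ρ : Y → L} (hρ : (Set.range ρ).Finite) {a : Cochain L n}
    {F : Point Y n → ℤ} (hF : IsPull ρ a F) (ha : IsAlt a) (h : IsCobd p (fibreClosure ρ) a) :
    IsExact p F := by
  cases n with
  | zero => exact hF.eq hρ (b := 0) (fun _ _ _ => rfl) h
  | succ n =>
    obtain ⟨b, hbr, hb, hab⟩ := h.exists_isAlt ha
    obtain ⟨B, hB⟩ := exists_isPull_of_cochain hρ b
    exact ⟨B, mem_of_isPull_of_finite_range hρ hb hbr hB,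
      (hF.eq hρ hB.coboundary hab).symm⟩

/-- Cochains from different labellings are compared on the common refinement. -/
theorem isExact_sub {V W : Type*} {ρ : Y → V} {τ : Y → W} (hρ : (Set.range ρ).Finite)
    (hτ : (Set.range τ).Finite) {a : Cochain V n} {b : Cochain W n} {F F' : Point Y n → ℤ}
    (hF : IsPull ρ a F) (hF' : IsPull τ b F') (ha : IsAlt a) (hb : IsAlt b)
    (h : IsCobd p (fibreClosure fun y => (ρ y, τ y)) (pull Prod.fst a - pull Prod.snd b)) :
    IsExact p (F - F') := by
  refine ((hF.comp (τ := fun y => (ρ y, τ y)) Prod.fst rfl).sub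
    (hF'.comp (τ := fun y => (ρ y, τ y)) Prod.snd rfl)).isExact ?_
    ((ha.pull _).sub (hb.pull _)) h
  refine (hρ.prod hτ).subset ?_
  rintro _ ⟨y, rfl⟩
  exact ⟨⟨y, rfl⟩, ⟨y, rfl⟩⟩

variable (p n) in
/-- The coboundary operator on the group of cochains. -/
def d : cochains n p →+ cochains (n + 1) p :=
  (coboundary.comp (cochains n p).subtype).codRestrict (cochains (n + 1) p)
    fun F => coboundary_mem F.2

theorem d_d (F : cochains n p) : d (n + 1) p (d n p F) = 0 :=
  Subtype.ext (coboundary_coboundary F.1)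

variable (p) in
/-- The complex of simple alternating cochains on ultrafilters. -/
def complex : CochainComplex AddCommGrpCat.{u} ℕ :=
  CochainComplex.of (fun n => AddCommGrpCat.of (cochains n p))
    (fun n => AddCommGrpCat.ofHom (d n p))
    (fun _ => AddCommGrpCat.hom_ext (AddMonoidHom.ext d_d))

end UltraCochain

/-! ### Cohomology classes in complexes given by sequences of groups -/

namespace CochainComplex

variable {X X' : ℕ → Type w} [∀ n, AddCommGroup (X n)] [∀ n, AddCommGroup (X' n)]
  (d : ∀ n, X n →+ X (n + 1)) (sq : ∀ n x, d (n + 1) (d n x) = 0)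
  (e : ∀ n, X' n →+ X' (n + 1)) (sqe : ∀ n x, e (n + 1) (e n x) = 0)

/-- The cochain complex given by a sequence of groups and homomorphisms. -/
abbrev ofAb : CochainComplex AddCommGrpCat.{w} ℕ :=
  of (fun n => AddCommGrpCat.of (X n)) (fun n => AddCommGrpCat.ofHom (d n))
    (fun n => AddCommGrpCat.hom_ext (AddMonoidHom.ext (sq n)))

theorem ofAb_d (n : ℕ) : (ofAb d sq).d n (n + 1) = AddCommGrpCat.ofHom (d n) :=
  of_d (fun n => AddCommGrpCat.of (X n)) (fun n => AddCommGrpCat.ofHom (d n)) n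

theorem ker_ofAb_d (n : ℕ) : ((ofAb d sq).d n (n + 1)).hom.ker = (d n).ker := by
  rw [ofAb_d]; rfl

/-- The cohomology class of a cocycle. -/
noncomputable def ofClass (n : ℕ) : (d n).ker →+ (ofAb d sq).homology n :=
  ((ofAb d sq).abClass (CochainComplex.next ℕ n)).comp
    (AddSubgroup.inclusion (ker_ofAb_d d sq n).ge)

theorem ofClass_surjective (n : ℕ) : Function.Surjective (ofClass d sq n) := by
  intro y
  obtain ⟨x, rfl⟩ := (ofAb d sq).abClass_surjective (CochainComplex.next ℕ n) y
  exact ⟨⟨x.1, (ker_ofAb_d d sq n).le x.2⟩, rfl⟩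

theorem ofClass_zero_eq_zero_iff (x : (d 0).ker) : ofClass d sq 0 x = 0 ↔ x.1 = 0 := by
  refine ((ofAb d sq).abClass_eq_zero_iff (CochainComplex.next ℕ 0)
    CochainComplex.prev_nat_zero _).trans ?_
  -- The predecessor of 0 is 0 by default, with zero differential.
  have h : (ofAb d sq).d 0 0 = 0 := (ofAb d sq).shape _ _ (by simp)
  rw [h]
  exact ⟨fun ⟨_, hy⟩ => hy.symm, fun hx => ⟨(0 : X 0), hx.symm⟩⟩

theorem ofClass_succ_eq_zero_iff (n : ℕ) (x : (d (n + 1)).ker) :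
    ofClass d sq (n + 1) x = 0 ↔ ∃ y, d n y = x.1 := by
  refine ((ofAb d sq).abClass_eq_zero_iff (CochainComplex.next ℕ (n + 1))
    (CochainComplex.prev_nat_succ n) _).trans ?_
  rw [ofAb_d]
  rfl

theorem homologyMap_ofClass (φ : ofAb d sq ⟶ ofAb e sqe) {n : ℕ} (x : (d n).ker)
    (y : (e n).ker) (h : (φ.f n).hom x.1 = y.1) :
    (HomologicalComplex.homologyMap φ n).hom (ofClass d sq n x) = ofClass e sqe n y :=
  HomologicalComplex.homologyMap_abClass φ (CochainComplex.next ℕ n)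
    (AddSubgroup.inclusion (ker_ofAb_d d sq n).ge x)
    (AddSubgroup.inclusion (ker_ofAb_d e sqe n).ge y) h

end CochainComplex

namespace UltraCochain

open TupleCochain Nerve Topology

variable {Y : Type u} [TopologicalSpace Y] [T2Space Y] [CompactSpace Y] {n : ℕ} {p : Y}

/-- The class of a cocycle in the complex of simple alternating cochains. -/
noncomputable def toHomology (n : ℕ) (p : Y) : (d n p).ker →+ (complex p).homology n :=
  CochainComplex.ofClass (fun n => d n p) (fun _ => d_d) n

theorem toHomology_surjective : Function.Surjective (toHomology n p) :=
  CochainComplex.ofClass_surjective (fun n => d n p) (fun _ => d_d) n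

theorem toHomology_eq_zero_iff (x : (d n p).ker) : toHomology n p x = 0 ↔ IsExact p x.1.1 := by
  cases n with
  | zero =>
    exact (CochainComplex.ofClass_zero_eq_zero_iff (fun n => d n p) (fun _ => d_d) x).trans
      Subtype.ext_iff
  | succ n =>
    refine (CochainComplex.ofClass_succ_eq_zero_iff (fun n => d n p) (fun _ => d_d) n x).trans ⟨?_, ?_⟩
    · rintro ⟨y, hy⟩
      exact ⟨y.1, y.2, congrArg Subtype.val hy⟩
    · rintro ⟨B, hB, h⟩
      exact ⟨⟨B, hB⟩, Subtype.ext h⟩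

end UltraCochain

/-! ### The isomorphism from Čech cohomology to the cohomology of cochains on ultrafilters -/

namespace Cech

open TupleCochain Nerve UltraCochain

variable {Y : Type u} [TopologicalSpace Y] {n : ℕ} {p : Y} {α β : OpenCover Y}

/-- The class of a cocycle in the complex of relative cochains of a cover. -/
noncomputable def toHomology (n : ℕ) (p : Y) (α : OpenCover Y) :
    (coboundary {p} α n).ker →+ (complex {p} α).homology n :=
  CochainComplex.ofClass (coboundary {p} α) (coboundary_coboundary {p} α) n

theorem toHomology_surjective : Function.Surjective (toHomology n p α) :=
  CochainComplex.ofClass_surjective (coboundary {p} α) (coboundary_coboundary {p} α) n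

theorem toHomology_eq_zero (x : (coboundary {p} α n).ker)
    (h : IsCobd p (fun U : α.sets => U.1) (extend x.1)) : toHomology n p α x = 0 := by
  cases n with
  | zero =>
    refine (CochainComplex.ofClass_zero_eq_zero_iff (coboundary {p} α)
      (coboundary_coboundary {p} α) x).2 (Subtype.ext (funext fun s => ?_))
    exact (extend_apply x.1 s).symm.trans (h s.1 (isSimplex_iff.2 s.2))
  | succ n =>
    obtain ⟨b, hb, hxb⟩ := h
    refine (CochainComplex.ofClass_succ_eq_zero_iff (coboundary {p} α)
      (coboundary_coboundary {p} α) n x).2 ⟨restrict b hb, ?_⟩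
    refine Subtype.ext (funext fun s => ?_)
    exact ((extend_apply x.1 s).symm.trans (hxb s.1 (isSimplex_iff.2 s.2))).symm

/-- The pullback of a cocycle along a projection. -/
def pullbackKer (q : Projection α β) (x : (coboundary {p} α n).ker) :
    (coboundary {p} β n).ker :=
  ⟨q.pullback {p} n x.1, by
    have h : coboundary {p} β n (q.pullback {p} n x.1) =
        q.pullback {p} (n + 1) (coboundary {p} α n x.1) := rfl
    rw [AddMonoidHom.mem_ker, h, x.2, map_zero]⟩

theorem homologyMap_toHomology (q : Projection α β) (x : (coboundary {p} α n).ker) :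
    (HomologicalComplex.homologyMap (q.map {p}) n).hom (toHomology n p α x) =
      toHomology n p β (pullbackKer q x) :=
  CochainComplex.homologyMap_ofClass (coboundary {p} α) (coboundary_coboundary {p} α)
    (coboundary {p} β) (coboundary_coboundary {p} β) (q.map {p}) x (pullbackKer q x) rfl

/-- The vertices of a nerve are linearly ordered in an arbitrary way. -/
noncomputable instance (α : OpenCover Y) : LinearOrder α.sets :=
  IsWellOrder.linearOrder WellOrderingRel

/-- Alternation does not change the cohomology class. -/
theorem isCobd_pull_alt_sub {L : Type*} {Z : L → Set Y} (φ : L → α.sets)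
    (hφ : ∀ l, Z l ⊆ (φ l).1) (x : (coboundary {p} α n).ker) :
    IsCobd p Z (pull φ (extend x.1) - pull φ (alt (extend x.1))) := by
  rw [← map_sub]
  exact (isCobd_sub_alt (isRel_extend x.1) (isCocycle_extend x.2)).pull_of_subset hφ

/-- A section of the indexing of a cover by a family. -/
theorem exists_section {L : Type*} (O : L → Set Y) (hO : ∀ l, IsOpen (O l))
    (hc : ∀ y, ∃ l, y ∈ O l) :
    ∃ σ : (OpenCover.ofFamily O hO hc).sets → L, ∀ U, U.1 = O (σ U) := by
  choose σ hσ using fun U : (OpenCover.ofFamily O hO hc).sets => U.2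
  exact ⟨σ, fun U => (hσ U).symm⟩

variable [T2Space Y] [CompactSpace Y]

/-- A chosen finite partition subordinate to a cover. -/
noncomputable def part (α : OpenCover Y) : Y → α.sets := α.exists_partition.choose

theorem finite_range_part (α : OpenCover Y) : (Set.range (part α)).Finite :=
  α.exists_partition.choose_spec.1

theorem fibreClosure_part (α : OpenCover Y) (U : α.sets) : fibreClosure (part α) U ⊆ U.1 :=
  α.exists_partition.choose_spec.2 U

/-- The alternating cochain on ultrafilters obtained from a cochain on the nerve of a cover. -/
noncomputable def thetaFun (c : cochains {p} α n) : Point Y n → ℤ :=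
  (exists_isPull_of_cochain (finite_range_part α) (alt (extend c))).choose

theorem isPull_thetaFun (c : cochains {p} α n) :
    IsPull (part α) (alt (extend c)) (thetaFun c) :=
  (exists_isPull_of_cochain (finite_range_part α) (alt (extend c))).choose_spec

theorem isRel_alt_extend (c : cochains {p} α n) :
    IsRel p (fibreClosure (part α)) (alt (extend c)) :=
  ((isRel_extend c).alt).pull (φ := id) fun U hU => fibreClosure_part α U hU

theorem thetaFun_mem (c : cochains {p} α n) : thetaFun c ∈ UltraCochain.cochains n p :=
  mem_of_isPull_of_finite_range (finite_range_part α) (isAlt_alt _) (isRel_alt_extend c)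
    (isPull_thetaFun c)

/-- `thetaFun` as a homomorphism. -/
noncomputable def thetaHom (n : ℕ) (p : Y) (α : OpenCover Y) :
    cochains {p} α n →+ UltraCochain.cochains n p :=
  AddMonoidHom.mk' (fun c => ⟨thetaFun c, thetaFun_mem c⟩) fun c c' => Subtype.ext <|
    (isPull_thetaFun (c + c')).eq (finite_range_part α)
      ((isPull_thetaFun c).add (isPull_thetaFun c')) fun t _ => by rw [map_add, map_add]

/-- Extension by zero commutes with δ only on the nerve of `α`, but the simplices of the fibre
closures all lie there. -/
theorem thetaHom_coboundary (c : cochains {p} α n) :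
    thetaHom (n + 1) p α (coboundary {p} α n c) = UltraCochain.d n p (thetaHom n p α c) := by
  refine Subtype.ext ((isPull_thetaFun (coboundary {p} α n c)).eq (finite_range_part α)
    (isPull_thetaFun c).coboundary fun t ht => ?_)
  rw [← alt_δ, ← sub_eq_zero, ← Pi.sub_apply, ← map_sub]
  refine alt_eq_zero fun t' ht' => ?_
  have hs := (ht.of_range_subset ht').mono (fibreClosure_part α)
  rw [Pi.sub_apply, extend_apply _ ⟨t', isSimplex_iff.1 hs⟩,
    δ_extend_apply _ ⟨t', isSimplex_iff.1 hs⟩, sub_self]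

/-- The comparison map from the cochains of a cover to the cochains on ultrafilters. -/
noncomputable def theta (p : Y) (α : OpenCover Y) : complex {p} α ⟶ UltraCochain.complex p :=
  CochainComplex.ofHom (fun n => AddCommGrpCat.ofHom (thetaHom n p α)) (fun n => by
    simp only [complex, UltraCochain.complex, CochainComplex.of_d]
    exact AddCommGrpCat.hom_ext (AddMonoidHom.ext fun c => (thetaHom_coboundary c).symm))

/-- The image of a cocycle under the comparison map. -/
noncomputable def thetaKer (x : (coboundary {p} α n).ker) : (UltraCochain.d n p).ker :=
  ⟨thetaHom n p α x.1, by
    rw [AddMonoidHom.mem_ker, ← thetaHom_coboundary, x.2, map_zero]⟩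

theorem homologyMap_theta (x : (coboundary {p} α n).ker) :
    (HomologicalComplex.homologyMap (theta p α) n).hom (toHomology n p α x) =
      UltraCochain.toHomology n p (thetaKer x) :=
  CochainComplex.homologyMap_ofClass (coboundary {p} α) (coboundary_coboundary {p} α)
    (fun n => UltraCochain.d n p) (fun _ => d_d) (theta p α) x (thetaKer x) rfl

theorem toHomology_eq_of_isExact {x y : (UltraCochain.d n p).ker}
    (h : IsExact p (x.1.1 - y.1.1)) :
    UltraCochain.toHomology n p x = UltraCochain.toHomology n p y := by
  rw [← sub_eq_zero, ← map_sub]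
  exact (UltraCochain.toHomology_eq_zero_iff _).2 h

/-- On the common refinement of the two partitions, the labels in `α` and the projected labels in
`β` are contiguous; alternation is removed on both sides first. -/
theorem toHomology_thetaKer_pullbackKer (q : Projection α β) (x : (coboundary {p} α n).ker) :
    UltraCochain.toHomology n p (thetaKer (pullbackKer q x)) =
      UltraCochain.toHomology n p (thetaKer x) := by
  refine (toHomology_eq_of_isExact ?_).symm
  refine isExact_sub (finite_range_part α) (finite_range_part β) (isPull_thetaFun _)
    (isPull_thetaFun _) (isAlt_alt _) (isAlt_alt _) ?_
  have h1 : ∀ l, fibreClosure (fun y => (part α y, part β y)) l ⊆ l.1.1 := fun l =>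
    (fibreClosure_subset Prod.fst rfl l).trans (fibreClosure_part α l.1)
  have h2 : ∀ l, fibreClosure (fun y => (part α y, part β y)) l ⊆ l.2.1 := fun l =>
    (fibreClosure_subset Prod.snd rfl l).trans (fibreClosure_part β l.2)
  refine (isCobd_pull_alt_sub Prod.fst h1 x).symm.trans ?_
  refine IsCobd.trans ?_ (isCobd_pull_alt_sub Prod.snd h2 (pullbackKer q x))
  refine (isCobd_pull_sub_pull (ψ := q.toFun ∘ Prod.snd) h1
    (fun l => (h2 l).trans (q.subset l.2)) (isRel_extend x.1) (isCocycle_extend x.2)).trans ?_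
  refine isCobd_sub_of_eq fun s hs => ?_
  exact (extend_pullback_apply q x.1 (isSimplex_comp h2 s hs)).symm

open Classical in
variable (n p) in
/-- The comparison map from Čech cohomology. -/
noncomputable def comparison :
    cohomology {p} n →+ (UltraCochain.complex p).homology n :=
  AddCommGroup.DirectLimit.lift _ _ _
    (fun α => (HomologicalComplex.homologyMap (theta p α) n).hom) (fun α β h x => by
      obtain ⟨x, rfl⟩ := toHomology_surjective x
      rw [homologyMap_toHomology, homologyMap_theta, homologyMap_theta,
        toHomology_thetaKer_pullbackKer])

open Classical in
variable (n p) in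
/-- The canonical map from the cohomology of a cover to Čech cohomology. -/
noncomputable def ofCover (α : OpenCover Y) : (complex {p} α).homology n →+ cohomology {p} n :=
  AddCommGroup.DirectLimit.of (fun α : OpenCover Y => ((complex {p} α).homology n : Type u))
    (fun _ _ h => (HomologicalComplex.homologyMap ((projection h).map {p}) n).hom) α

open Classical in
theorem comparison_ofCover (x : (coboundary {p} α n).ker) :
    comparison n p (ofCover n p α (toHomology n p α x)) =
      UltraCochain.toHomology n p (thetaKer x) := by
  refine Eq.trans ?_ (homologyMap_theta x)
  exact AddCommGroup.DirectLimit.lift_of _ _ _ _ _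

/-- A cocycle is pulled back from a cochain on the fibre closures of a finite labelling; these swell
to an open cover with the same nerve, on which that cochain is still a relative cocycle. The section
`σ` is needed because distinct labels may give the same open set. -/
theorem comparison_surjective : Function.Surjective (comparison n p) := by
  intro z
  obtain ⟨F, rfl⟩ := UltraCochain.toHomology_surjective z
  obtain ⟨L, _, ρ, a, ha, har, hF⟩ := exists_isPull F.1.2
  obtain ⟨O, hO, hZO, -, hpO, hsO⟩ := exists_swelling p (Z := fibreClosure ρ)
    (W := fun _ => Set.univ) (fun _ => isClosed_closure) (fun _ => isOpen_univ)
    (fun _ => Set.subset_univ _)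
  have hcov : ∀ y, ∃ l, y ∈ O l := fun y => ⟨ρ y, hZO _ (subset_closure rfl)⟩
  obtain ⟨σ, hσ⟩ := exists_section O hO hcov
  have haO : IsRel p O a := fun s hs => har s fun i => hpO _ (hs i)
  have hcoc : IsCocycle O a := by
    intro t ht
    have hd : UltraCochain.coboundary F.1.1 = 0 := congrArg Subtype.val F.2
    have hF0 : IsPull ρ (δ a) 0 := hd ▸ hF.coboundary
    exact hF0.apply_eq (b := 0) (fun _ _ _ => rfl) (hsO t ht)
  have hσs : ∀ U, U.1 ⊆ O (σ U) := fun U => (hσ U).le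
  have hrel : IsRel p (fun U : (OpenCover.ofFamily O hO hcov).sets => U.1) (pull σ a) :=
    haO.pull fun U hU => hσs U hU
  let x : (coboundary {p} (OpenCover.ofFamily O hO hcov) n).ker := ⟨restrict (pull σ a) hrel, by
    refine Subtype.ext (funext fun s => ?_)
    exact hcoc _ (isSimplex_comp hσs s.1 (isSimplex_iff.2 s.2))⟩
  refine ⟨ofCover n p _ (toHomology n p _ x), ?_⟩
  rw [comparison_ofCover]
  refine toHomology_eq_of_isExact (isExact_sub (finite_range_part _)
    (Set.toFinite (Set.range ρ)) (isPull_thetaFun _) hF (isAlt_alt _) ha ?_)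
  have h1 : ∀ l, fibreClosure (fun y => (part (OpenCover.ofFamily O hO hcov) y, ρ y)) l ⊆ l.1.1 :=
    fun l => (fibreClosure_subset Prod.fst rfl l).trans (fibreClosure_part _ l.1)
  have h2 : ∀ l, fibreClosure (fun y => (part (OpenCover.ofFamily O hO hcov) y, ρ y)) l ⊆ O l.2 :=
    fun l => (fibreClosure_subset Prod.snd rfl l).trans (hZO l.2)
  refine (isCobd_pull_alt_sub Prod.fst h1 x).symm.trans ?_
  refine IsCobd.trans (isCobd_sub_of_eq (d := pull (σ ∘ Prod.fst) a) fun s hs => ?_) ?_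
  · exact extend_restrict_apply hrel (isSimplex_comp h1 s hs)
  · exact isCobd_pull_sub_pull (fun l => (h1 l).trans (hσs _)) h2 haO hcoc

/-- If the image of a cocycle is exact then the cocycle is cohomologous to zero on a finite
partition that refines the chosen one. -/
theorem exists_isCobd_of_isExact (x : (coboundary {p} α n).ker)
    (hx : IsExact p (thetaFun x.1)) : ∃ (L : Type u) (_ : Finite L) (ρ : Y → L) (q : L → α.sets),
      (∀ l, fibreClosure ρ l ⊆ (q l).1) ∧ IsCobd p (fibreClosure ρ) (pull q (extend x.1)) := by
  obtain ⟨M, τ, hτ, h⟩ : ∃ (M : Type u) (τ : Y → M × α.sets), (∀ l, fibreClosure τ l ⊆ l.2.1) ∧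
      (Set.range τ).Finite ∧ IsCobd p (fibreClosure τ) (pull Prod.snd (alt (extend x.1))) := by
    cases n with
    | zero =>
      refine ⟨PUnit, fun y => (⟨⟩, part α y), fun l => ?_, ?_, fun t ht => ?_⟩
      · exact (fibreClosure_subset Prod.snd rfl l).trans (fibreClosure_part α l.2)
      · refine ((Set.finite_univ).prod (finite_range_part α)).subset ?_
        rintro _ ⟨y, rfl⟩
        exact ⟨trivial, ⟨y, rfl⟩⟩
      · have h0 : thetaFun x.1 = 0 := hx
        have := (isPull_thetaFun x.1).apply_eq (b := 0) (h0 ▸ fun _ _ _ => rfl)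
          (isSimplex_comp (Z := fibreClosure (part α)) (fibreClosure_subset Prod.snd rfl) t ht)
        exact this
    | succ n =>
      -- A primitive `B` comes from a finite labelling `μ`; pairing `μ` with the chosen partition
      -- puts both cochains on one nerve.
      obtain ⟨B, hB, hBx⟩ := hx
      obtain ⟨M, _, μ, b, hb, hbr, hbB⟩ := exists_isPull hB
      let τ : Y → M × α.sets := fun y => (μ y, part α y)
      refine ⟨M, τ, fun l => ?_, ?_, pull Prod.fst b, ?_, fun t ht => ?_⟩
      · exact (fibreClosure_subset Prod.snd rfl l).trans (fibreClosure_part α l.2)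
      · refine ((Set.toFinite (Set.range μ)).prod (finite_range_part α)).subset ?_
        rintro _ ⟨y, rfl⟩
        exact ⟨⟨y, rfl⟩, ⟨y, rfl⟩⟩
      · exact hbr.pull fun w hw => fibreClosure_subset (τ := τ) Prod.fst rfl w hw
      · have h1 := (isPull_thetaFun x.1).comp (τ := τ) Prod.snd rfl
        have h2 := (hbB.comp (τ := τ) Prod.fst rfl).coboundary
        rw [hBx] at h2
        exact h1.apply_eq h2 ht
  obtain ⟨hfin, h⟩ := h
  have := hfin.to_subtype
  -- The cover may be infinite, so the labels are restricted to the finite range of `τ`.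
  refine ⟨Set.range τ, inferInstance, Set.rangeFactorization τ, fun l => l.1.2, fun l => ?_, ?_⟩
  · exact (fibreClosure_subset Subtype.val rfl l).trans (hτ l.1)
  · have h' := ((isCobd_pull_alt_sub Prod.snd hτ x).add h)
    rw [sub_add_cancel] at h'
    exact h'.pull_of_subset (fibreClosure_subset Subtype.val rfl)

open Classical in
-- The fibre closures of the partition where the cocycle bounds are swollen inside members of `α`.
-- The result is a refinement of `α` with the same nerve, so the class already dies there.
theorem comparison_injective : Function.Injective (comparison n p) := by
  refine (injective_iff_map_eq_zero _).2 fun z hz => ?_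
  induction z using AddCommGroup.DirectLimit.induction_on with
  | ih α y =>
    obtain ⟨x, rfl⟩ := toHomology_surjective y
    change ofCover n p α _ = 0
    replace hz : comparison n p (ofCover n p α (toHomology n p α x)) = 0 := hz
    rw [comparison_ofCover, UltraCochain.toHomology_eq_zero_iff] at hz
    obtain ⟨L, _, ρ, q, hq, hcob⟩ := exists_isCobd_of_isExact x hz
    obtain ⟨O, hO, hZO, hOW, hpO, hsO⟩ := exists_swelling p (Z := fibreClosure ρ)
      (W := fun l => (q l).1) (fun _ => isClosed_closure) (fun l => α.isOpen _ (q l).2) hq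
    have hcov : ∀ y, ∃ l, y ∈ O l := fun y => ⟨ρ y, hZO _ (subset_closure rfl)⟩
    obtain ⟨σ, hσ⟩ := exists_section O hO hcov
    have hαβ : α ≤ OpenCover.ofFamily O hO hcov := by
      rintro _ ⟨l, rfl⟩
      exact ⟨(q l).1, (q l).2, hOW l⟩
    have hmap : ofCover n p _ ((HomologicalComplex.homologyMap ((projection hαβ).map {p}) n).hom
        (toHomology n p α x)) = ofCover n p α (toHomology n p α x) :=
      AddCommGroup.DirectLimit.of_f _ _
    rw [← hmap, homologyMap_toHomology, toHomology_eq_zero, map_zero]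
    have hσs : ∀ U, U.1 ⊆ O (σ U) := fun U => (hσ U).le
    have h1 : IsCobd p (fun U : (OpenCover.ofFamily O hO hcov).sets => U.1)
        (pull (q ∘ σ) (extend x.1)) :=
      hcob.pull (φ := σ) (fun U hU => hpO _ (hσs U hU))
        fun s hs => hsO _ (isSimplex_comp hσs s hs)
    have h2 := (isCobd_pull_sub_pull (projection hαβ).subset
      (fun U => (hσs U).trans (hOW (σ U))) (ψ := q ∘ σ)
      (isRel_extend x.1) (isCocycle_extend x.2)).add h1
    rw [sub_add_cancel] at h2
    exact h2.congr fun s hs => extend_pullback_apply _ x.1 hs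

variable (n p) in
/-- The class in Čech cohomology of a cocycle on ultrafilters. -/
theorem exists_toCohomology : ∃ θ : (UltraCochain.d n p).ker →+ cohomology {p} n,
    Function.Surjective θ ∧ ∀ x, θ x = 0 ↔ IsExact p x.1.1 := by
  let e := AddEquiv.ofBijective (comparison n p) ⟨comparison_injective, comparison_surjective⟩
  refine ⟨e.symm.toAddMonoidHom.comp (UltraCochain.toHomology n p),
    e.symm.surjective.comp UltraCochain.toHomology_surjective, fun x => ?_⟩
  rw [← UltraCochain.toHomology_eq_zero_iff]
  exact e.symm.map_eq_zero_iff

end Cech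

/-! ## Kolmogoroff chains as homomorphisms on the cochains of the one-point compactification -/

namespace Kolmogoroff

open UltraCochain (SetAway detFun detFun_mem)
open OnePoint (infty)

variable {X : Type u} [TopologicalSpace X]

theorem closure_coe_image (E : Bounded X) :
    closure ((↑) '' E.1 : Set (OnePoint X)) = (↑) '' closure E.1 := by
  refine (closure_minimal (Set.image_mono subset_closure)
    (OnePoint.isClosed_image_coe.2 ⟨isClosed_closure, E.2⟩)).antisymm
    (image_closure_subset_closure_image OnePoint.continuous_coe)

theorem isCompact_closure_preimage (E : SetAway (infty : OnePoint X)) :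
    IsCompact (closure ((↑) ⁻¹' E.1 : Set X)) := by
  have h := (OnePoint.isClosed_iff_of_notMem E.2).1 isClosed_closure
  exact h.2.of_isClosed_subset isClosed_closure
    (closure_minimal (Set.preimage_mono subset_closure) h.1)

/-- The bounded subsets of `X` are the subsets of its one-point compactification that stay away
from the point at infinity. -/
def Bounded.equiv : Bounded X ≃ SetAway (infty : OnePoint X) where
  toFun E := ⟨(↑) '' E.1, by rw [closure_coe_image]; exact OnePoint.infty_notMem_image_coe⟩
  invFun E := ⟨(↑) ⁻¹' E.1, isCompact_closure_preimage E⟩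
  left_inv E := Subtype.ext (Set.preimage_image_eq _ OnePoint.coe_injective)
  right_inv E := Subtype.ext (Set.image_preimage_eq_of_subset fun _ hy =>
    OnePoint.ne_infty_iff_exists.1 fun h => E.2 (subset_closure (h ▸ hy)))

theorem Bounded.closure_equiv (E : Bounded X) :
    closure (Bounded.equiv E).1 = (↑) '' closure E.1 := closure_coe_image E

variable {G : Type v} [AddCommGroup G] {n : ℕ}

theorem isChain_comp_equiv {f : (Fin (n + 1) → SetAway (infty : OnePoint X)) → G}
    (hf : UltraCochain.IsChain f) : IsChain X G n fun E => f (Bounded.equiv ∘ E) where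
  additive E i A B h := by
    simp only [Function.comp_update]
    exact hf.additive _ i _ _ _
      (Set.disjoint_image_of_injective OnePoint.coe_injective h)
      (Set.image_union _ _ _)
  perm E σ := hf.perm (Bounded.equiv ∘ E) σ
  eq_zero_of_eq E i j h h' := hf.eq_zero_of_eq _ i j h (congrArg Bounded.equiv h')
  eq_zero_of_closures E h := hf.eq_zero_of_closures _ fun ⟨y, hy⟩ => by
    simp only [Function.comp_apply, Bounded.closure_equiv] at hy
    obtain ⟨x, -, rfl⟩ := hy 0
    have hx : x ∈ ⋂ i, closure (E i).1 := Set.mem_iInter.2 fun i =>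
      (OnePoint.coe_injective.mem_set_image).1 (hy i)
    exact (h ▸ hx : x ∈ (∅ : Set X))

theorem IsChain.comp_equiv_symm {f : (Fin (n + 1) → Bounded X) → G} (hf : IsChain X G n f) :
    UltraCochain.IsChain fun E : Fin (n + 1) → SetAway (infty : OnePoint X) =>
      f (Bounded.equiv.symm ∘ E) where
  additive E i A B C h hC := by
    simp only [Function.comp_update]
    rw [← hf.additive _ i _ _ (h.preimage OnePoint.some)]
    congr 2
    exact Subtype.ext (congrArg (Set.preimage OnePoint.some) hC)
  perm E σ := hf.perm (Bounded.equiv.symm ∘ E) σ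
  eq_zero_of_eq E i j h h' := hf.eq_zero_of_eq _ i j h (congrArg Bounded.equiv.symm h')
  eq_zero_of_closures E h := hf.eq_zero_of_closures _ <| Set.eq_empty_of_forall_notMem
    fun x hx => h ⟨x, fun i => by
      have hi := Set.mem_image_of_mem ((↑) : X → OnePoint X) (Set.mem_iInter.1 hx i)
      rwa [← Bounded.closure_equiv, Function.comp_apply, Equiv.apply_symm_apply] at hi⟩

variable (X G n) in
/-- The Kolmogoroff chain given by a homomorphism on cochains. -/
noncomputable def ofHom :
    (UltraCochain.cochains n (infty : OnePoint X) →+ G) →+ chains X G n where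
  toFun φ := ⟨_, isChain_comp_equiv (UltraCochain.isChain_of_hom φ)⟩
  map_zero' := rfl
  map_add' _ _ := rfl

theorem ofHom_apply (φ : UltraCochain.cochains n (infty : OnePoint X) →+ G)
    (E : Fin (n + 1) → Bounded X) : (ofHom X G n φ).1 E =
      φ ⟨detFun fun i => (Bounded.equiv (E i)).1, detFun_mem fun i => (Bounded.equiv (E i)).2⟩ :=
  rfl

theorem ofHom_injective : Function.Injective (ofHom X G n) := by
  refine fun φ ψ h => UltraCochain.hom_ext fun E => ?_
  have hE := congrFun (congrArg Subtype.val h) (Bounded.equiv.symm ∘ E)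
  simpa only [ofHom_apply, Function.comp_apply, Equiv.apply_symm_apply] using hE

theorem ofHom_surjective : Function.Surjective (ofHom X G n) := by
  intro f
  obtain ⟨φ, hφ⟩ := (show IsChain X G n f.1 from f.2).comp_equiv_symm.exists_hom
  refine ⟨φ, Subtype.ext (funext fun E => ?_)⟩
  refine (hφ (Bounded.equiv ∘ E)).trans (congrArg f.1 ?_)
  funext i
  exact Bounded.equiv.symm_apply_apply (E i)

variable [LocallyCompactSpace X] [T2Space X]

/-- An open hull in `X` stays open in the compactification, so `coboundary_detFun` applies to its
image. -/
theorem boundary_ofHom (φ : UltraCochain.cochains (n + 1) (infty : OnePoint X) →+ G) :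
    boundary X G n (ofHom X G (n + 1) φ) =
      ofHom X G n (φ.comp (UltraCochain.d n (infty : OnePoint X))) := by
  refine Subtype.ext (funext fun E => ?_)
  obtain ⟨U, hU⟩ := exists_isHull E
  have hφ : IsChain X G (n + 1) (ofHom X G (n + 1) φ).1 := (ofHom X G (n + 1) φ).2
  refine (hφ.boundaryFun_eq E U hU).trans (congrArg φ (Subtype.ext ?_))
  refine Eq.trans ?_ (UltraCochain.coboundary_detFun (fun i => (Bounded.equiv (E i)).1)
    (U := (Bounded.equiv U).1) (OnePoint.isOpen_image_coe.2 hU.1) fun i => ?_).symm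
  · exact congrArg detFun (funext fun i => Fin.cases rfl (fun _ => rfl) i)
  · rw [Bounded.closure_equiv]
    exact Set.image_mono (hU.2 i)

theorem complex_d (n : ℕ) :
    (complex X G).d (n + 1) n = AddCommGrpCat.ofHom (boundary X G n) :=
  ChainComplex.of_d (fun n => AddCommGrpCat.of (chains X G n))
    (fun n => AddCommGrpCat.ofHom (boundary X G n)) n

/-- `B` plays the role of the coboundaries: its annihilator corresponds to the cycles. Leaving `j`
free covers degree 0 and positive degrees at once. -/
theorem exists_toHomology_of_mem_iff {j : ℕ} (hj : (ComplexShape.down ℕ).next n = j)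
    (B : AddSubgroup (UltraCochain.cochains n (infty : OnePoint X)))
    (hB : ∀ φ, φ ∈ B.annihilatorHom G ↔ ((complex X G).d n j).hom (ofHom X G n φ) = 0) :
    ∃ q : B.annihilatorHom G →+ homology X G n, Function.Surjective q ∧
      ∀ f, q f = 0 ↔ ∃ F : UltraCochain.cochains (n + 1) (infty : OnePoint X) →+ G,
        F.comp (UltraCochain.d n infty) = f.1 := by
  let c : B.annihilatorHom G →+ ((complex X G).d n j).hom.ker :=
    ((ofHom X G n).comp (B.annihilatorHom G).subtype).codRestrict _ fun f => (hB f.1).1 f.2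
  refine ⟨((complex X G).abClass hj).comp c, ?_, fun f => ?_⟩
  · refine ((complex X G).abClass_surjective hj).comp fun x => ?_
    obtain ⟨φ, hφ⟩ := ofHom_surjective (X := X) (G := G) (n := n) x.1
    exact ⟨⟨φ, (hB φ).2 ((congrArg _ hφ).trans x.2)⟩, Subtype.ext hφ⟩
  · refine ((complex X G).abClass_eq_zero_iff hj (ChainComplex.prev ℕ n) (c f)).trans ?_
    rw [complex_d]
    constructor
    · rintro ⟨y, hy⟩
      obtain ⟨F, rfl⟩ := ofHom_surjective (X := X) (G := G) (n := n + 1) y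
      exact ⟨F, ofHom_injective ((boundary_ofHom F).symm.trans hy)⟩
    · rintro ⟨F, hF⟩
      exact ⟨ofHom X G (n + 1) F, (boundary_ofHom F).trans (congrArg (ofHom X G n) hF)⟩

variable (X G n) in
theorem exists_toHomology :
    ∃ (B : AddSubgroup (UltraCochain.cochains n (infty : OnePoint X)))
      (q : B.annihilatorHom G →+ homology X G n),
      (∀ x, x ∈ B ↔ UltraCochain.IsExact infty x.1) ∧ Function.Surjective q ∧
      ∀ f, q f = 0 ↔ ∃ F : UltraCochain.cochains (n + 1) (infty : OnePoint X) →+ G,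
        F.comp (UltraCochain.d n infty) = f.1 := by
  cases n with
  | zero =>
    obtain ⟨q, hq⟩ := exists_toHomology_of_mem_iff (X := X) (G := G)
      ChainComplex.next_nat_zero ⊥ fun φ => by
        -- In degree 0 the next index is 0 by default and the differential is zero, so every chain
        -- is a cycle.
        rw [(complex X G).shape 0 0 (by simp)]
        refine iff_of_true ?_ rfl
        rintro _ rfl
        exact map_zero φ
    exact ⟨⊥, q, fun x => Subtype.ext_iff, hq⟩
  | succ n =>
    obtain ⟨q, hq⟩ := exists_toHomology_of_mem_iff (X := X) (G := G)
      (ChainComplex.next_nat_succ n) (UltraCochain.d n (infty : OnePoint X)).range fun φ => by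
        rw [complex_d]
        change _ ↔ boundary X G n (ofHom X G (n + 1) φ) = 0
        rw [boundary_ofHom, ← map_zero (ofHom X G n), ofHom_injective.eq_iff, DFunLike.ext_iff]
        exact ⟨fun h y => h _ ⟨y, rfl⟩, fun h => by rintro _ ⟨y, rfl⟩; exact h y⟩
    refine ⟨_, q, fun x => ?_, hq⟩
    exact ⟨fun ⟨y, hy⟩ => ⟨y.1, y.2, congrArg Subtype.val hy⟩,
      fun ⟨y, hy, h⟩ => ⟨⟨y, hy⟩, Subtype.ext h⟩⟩

end Kolmogoroff

/-! ### The universal coefficient sequence for Kolmogoroff homology -/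

theorem theorem5 {X : Type u} [TopologicalSpace X] [LocallyCompactSpace X] [ParacompactSpace X]
    [T2Space X] {G : Type v} [AddCommGroup G] (n : ℕ) :
    ∃ (i : ExtAb (Cech.cohomology {(OnePoint.infty : OnePoint X)} (n + 1)) G →+
          Kolmogoroff.homology X G n)
      (p : Kolmogoroff.homology X G n →+
          (Cech.cohomology {(OnePoint.infty : OnePoint X)} n →+ G)),
      Function.Injective i ∧ Function.Exact i p ∧ Function.Surjective p := by
  obtain ⟨B, q, hB, hq, hq0⟩ := Kolmogoroff.exists_toHomology X G n
  obtain ⟨θ, hθ, hθ0⟩ := Cech.exists_toCohomology n (OnePoint.infty : OnePoint X)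
  obtain ⟨θ', hθ', hθ0'⟩ := Cech.exists_toCohomology (n + 1) (OnePoint.infty : OnePoint X)
  refine exists_universalCoefficients (UltraCochain.d n OnePoint.infty)
    (UltraCochain.d (n + 1) OnePoint.infty) B (fun x hx => ?_) UltraCochain.d_d
    θ hθ (fun x => (hθ0 x).trans (hB x.1).symm) θ' hθ' (fun x => ?_) q hq hq0
  · cases n with
    | zero =>
      have hx0 : x = 0 := Subtype.ext ((hB x).1 hx)
      rw [hx0]
      exact zero_mem _
    | succ n =>
      obtain ⟨y, hy, h⟩ := (hB x).1 hx
      have hxy : UltraCochain.d n OnePoint.infty ⟨y, hy⟩ = x := Subtype.ext h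
      rw [← hxy]
      exact UltraCochain.d_d _
  · exact (hθ0' x).trans ⟨fun ⟨y, hy, h⟩ => ⟨⟨y, hy⟩, Subtype.ext h⟩,
      fun ⟨y, hy⟩ => ⟨y.1, y.2, congrArg Subtype.val hy⟩⟩
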